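/- Let $(\hat M,\hat g_0)$ and $(\check M,\check g_0)$ be smooth finite-dimensional Riemannian manifolds, let $M=\hat M\times\check M$, let $T>0$, and let $g(t)$, $t\in[0,T]$, be a family of Riemannian metrics, smooth on $M\times[0,T]$, that solves the Ricci flow $\partial_t g=-2\,\mathrm{Rc}$ with $g(0)=\hat g_0\oplus\check g_0$ (completeness is not needed). Let $\hat\pi,\check\pi$ be the projections of $M$ onto its factors, and let $\hat P(t),\check P(t)$, $t\in[0,T]$, be the families of endomorphisms of $TM$ that solve, in each fibre, the ODEs $$\partial_t\hat P=\mathrm{Rc}\circ\hat P-\hat P\circ\mathrm{Rc},\qquad \partial_t\check P=\mathrm{Rc}\circ\check P-\check P\circ\mathrm{Rc},$$ where $\hat P(0)$ and $\check P(0)$ are the $g(0)$-orthogonal projections onto $\ker d\check\pi$ and $\ker d\hat\pi$. Define endomorphisms of $\Lambda^2T^*M$ by $$\mathcal P\omega(X,Y)=\omega(\hat PX,\check PY)+\omega(\check PX,\hat PY),\qquad \mathcal R=\mathrm{Rm}\circ\mathcal P,$$ where $\mathrm{Rm}:\Lambda^2T^*M\to\Lambda^2T^*M$ is the curvature operator of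 $g(t)$. Let $\nabla$ be the Levi-Civita connection of $g(t)$, and let $D_t=\partial_t+R_{ab}g^{bc}\Lambda^a_c$ act on time-dependent tensor fields, where $$\Lambda^a_bA^{j_1\dots j_k}_{i_1\dots i_l}=\delta^a_{i_1}A^{j_1\dots j_k}_{b\,i_2\dots i_l}+\dots+\delta^a_{i_l}A^{j_1\dots j_k}_{i_1\dots b}-\delta^{j_1}_bA^{a\dots j_k}_{i_1\dots i_l}-\dots-\delta^{j_k}_bA^{j_1\dots a}_{i_1\dots i_l}.$$ Then, at $t=0$ and at every point of $M$, for all integers $k,l\ge0$, $$D_t^k\nabla^{(l)}\mathcal R=0,\qquad D_t^k\nabla^{(l+1)}\mathcal P=0.$$ -/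

import Mathlib

open Bundle
open scoped Manifold ContDiff

noncomputable section

namespace RicciProduct

/-! ### Tensor calculus in a coordinate domain

`E` is the coordinate space with basis `b`, indexed by `ι`. A time-dependent metric is given by its
matrix of components `G y t = (g_{ij}(y, t))`, where `y` are the coordinates of the point.
All time derivatives are taken within the time interval `[0, T]` (one-sided at its ends). -/

/-- Components `A^{J}_{I}(y, t)` of a time-dependent tensor field with `p` upper and `q` lower
indices. -/
abbrev TensorField (E ι : Type*) (p q : ℕ) : Type _ :=
  E → ℝ → (Fin p → ι) → (Fin q → ι) → ℝ

/-- The partial derivative `∂_i f` at the point with coordinates `y`. -/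
def pd {E ι : Type*} [NormedAddCommGroup E] [NormedSpace ℝ E] (b : Module.Basis ι ℝ E)
    (i : ι) (f : E → ℝ) (y : E) : ℝ :=
  fderiv ℝ f y (b i)

/-- Christoffel symbols of the Levi-Civita connection:
`Γ^k_{ij} = 1/2 ∑_l g^{kl} (∂_i g_{jl} + ∂_j g_{il} - ∂_l g_{ij})`. -/
def christoffel {E ι : Type*} [NormedAddCommGroup E] [NormedSpace ℝ E] [Fintype ι] [DecidableEq ι]
    (b : Module.Basis ι ℝ E) (G : E → ℝ → Matrix ι ι ℝ) (k i j : ι) (y : E) (t : ℝ) : ℝ :=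
  (1 / 2) * ∑ l, (G y t)⁻¹ k l *
    (pd b i (fun z => G z t j l) y + pd b j (fun z => G z t i l) y
      - pd b l (fun z => G z t i j) y)

/-- Curvature of type (3,1): `R(∂_i, ∂_j) ∂_k = ∑_l R_{ijk}^l ∂_l`, where
`R(X, Y) Z = ∇_X ∇_Y Z - ∇_Y ∇_X Z - ∇_{[X,Y]} Z`. -/
def curv {E ι : Type*} [NormedAddCommGroup E] [NormedSpace ℝ E] [Fintype ι] [DecidableEq ι]
    (b : Module.Basis ι ℝ E) (G : E → ℝ → Matrix ι ι ℝ) (i j k l : ι) (y : E) (t : ℝ) : ℝ :=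
  pd b i (fun z => christoffel b G l j k z t) y - pd b j (fun z => christoffel b G l i k z t) y
    + ∑ p, (christoffel b G l i p y t * christoffel b G p j k y t
      - christoffel b G l j p y t * christoffel b G p i k y t)

/-- Curvature of type (4,0): `R_{ijkl} = g(R(∂_i, ∂_j) ∂_k, ∂_l)`, so that `R_{ijji} > 0` on
round spheres. -/
def curvLow {E ι : Type*} [NormedAddCommGroup E] [NormedSpace ℝ E] [Fintype ι] [DecidableEq ι]
    (b : Module.Basis ι ℝ E) (G : E → ℝ → Matrix ι ι ℝ) (i j k l : ι) (y : E) (t : ℝ) : ℝ :=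
  ∑ m, G y t l m * curv b G i j k m y t

/-- The Ricci tensor `R_{jk} = ∑_i R_{ijk}^i`. -/
def ricci {E ι : Type*} [NormedAddCommGroup E] [NormedSpace ℝ E] [Fintype ι] [DecidableEq ι]
    (b : Module.Basis ι ℝ E) (G : E → ℝ → Matrix ι ι ℝ) (y : E) (t : ℝ) : Matrix ι ι ℝ :=
  Matrix.of fun j k => ∑ i, curv b G i j k i y t

/-- The Ricci endomorphism `Rc` of the tangent bundle: its matrix has entry `g^{ik} R_{kj}` in
row `i` and column `j`. -/
def ricciEnd {E ι : Type*} [NormedAddCommGroup E] [NormedSpace ℝ E] [Fintype ι] [DecidableEq ι]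
    (b : Module.Basis ι ℝ E) (G : E → ℝ → Matrix ι ι ℝ) (y : E) (t : ℝ) : Matrix ι ι ℝ :=
  (G y t)⁻¹ * ricci b G y t

/-- The covariant derivative `∇ A`; the new lower index (the direction of differentiation) is
the first one. -/
def nabla {E ι : Type*} [NormedAddCommGroup E] [NormedSpace ℝ E] [Fintype ι] [DecidableEq ι]
    (b : Module.Basis ι ℝ E) (G : E → ℝ → Matrix ι ι ℝ) {p q : ℕ} (A : TensorField E ι p q) :
    TensorField E ι p (q + 1) :=
  fun y t J I' =>
    let a : ι := I' 0
    let I : Fin q → ι := Fin.tail I'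
    pd b a (fun z => A z t J I) y
      + ∑ r, ∑ c, christoffel b G (J r) a c y t * A y t (Function.update J r c) I
      - ∑ s, ∑ c, christoffel b G c a (I s) y t * A y t J (Function.update I s c)

/-- The iterated covariant derivative `∇^{(l)} A`. -/
def nablaIter {E ι : Type*} [NormedAddCommGroup E] [NormedSpace ℝ E] [Fintype ι] [DecidableEq ι]
    (b : Module.Basis ι ℝ E) (G : E → ℝ → Matrix ι ι ℝ) {p q : ℕ} (A : TensorField E ι p q) :
    (l : ℕ) → TensorField E ι p (q + l)
  | 0 => A
  | l + 1 => nabla b G (nablaIter b G A l)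

/-- The algebraic operator `Λ^a_c` on tensors:
`Λ^a_c A^J_I = ∑_s δ^a_{i_s} A^J_{I[i_s → c]} - ∑_r δ^{j_r}_c A^{J[j_r → a]}_I`. -/
def lam {ι : Type*} [DecidableEq ι] {p q : ℕ} (a c : ι)
    (A : (Fin p → ι) → (Fin q → ι) → ℝ) (J : Fin p → ι) (I : Fin q → ι) : ℝ :=
  (∑ s, if a = I s then A J (Function.update I s c) else 0)
    - ∑ r, if J r = c then A (Function.update J r a) I else 0

/-- The operator `D_t = ∂_t + R_{ab} g^{bc} Λ^a_c` on time-dependent tensor fields. -/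
def Dt {E ι : Type*} [NormedAddCommGroup E] [NormedSpace ℝ E] [Fintype ι] [DecidableEq ι]
    (b : Module.Basis ι ℝ E) (G : E → ℝ → Matrix ι ι ℝ) (T : ℝ) {p q : ℕ}
    (A : TensorField E ι p q) : TensorField E ι p q :=
  fun y t J I =>
    derivWithin (fun s => A y s J I) (Set.Icc 0 T) t
      + ∑ a, ∑ d, ∑ c, ricci b G y t a d * (G y t)⁻¹ d c * lam a c (A y t) J I

/-! ### Endomorphisms of the bundle of 2-forms

A 2-form is given by the antisymmetric matrix `η i j = η(∂_i, ∂_j)`. -/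

/-- The curvature operator `Rm` on 2-forms, `(Rm η)_{ij} = g^{kp} g^{lq} R_{ijpq} η_{lk}`;
equivalently `Rm(X^* ∧ Y^*)(Z, W) = 2 R(X, Y, W, Z)`. -/
def curvOp {E ι : Type*} [NormedAddCommGroup E] [NormedSpace ℝ E] [Fintype ι] [DecidableEq ι]
    (b : Module.Basis ι ℝ E) (G : E → ℝ → Matrix ι ι ℝ) (y : E) (t : ℝ)
    (η : Matrix ι ι ℝ) : Matrix ι ι ℝ :=
  Matrix.of fun i j => ∑ k, ∑ l, ∑ p, ∑ q,
    (G y t)⁻¹ k p * (G y t)⁻¹ l q * curvLow b G i j p q y t * η l k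

/-- `(𝒫 η)(X, Y) = η(P̂ X, P̌ Y) + η(P̌ X, P̂ Y)`, where the matrices `Ph`, `Pc` of the
endomorphisms `P̂`, `P̌` have the upper index as row: `P̂ ∂_i = ∑_k Ph k i ∂_k`. -/
def mixOp {ι : Type*} [Fintype ι] (Ph Pc : Matrix ι ι ℝ) (η : Matrix ι ι ℝ) : Matrix ι ι ℝ :=
  Matrix.of fun i j => ∑ k, ∑ l, (Ph k i * Pc l j * η k l + Pc k i * Ph l j * η k l)

/-- The 2-form `dx^k ∧ dx^l`. -/
def wedge {ι : Type*} [DecidableEq ι] (k l : ι) : Matrix ι ι ℝ :=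
  Matrix.of fun i j =>
    (if i = k ∧ j = l then (1 : ℝ) else 0) - (if i = l ∧ j = k then (1 : ℝ) else 0)

/-- The endomorphism field `A` of the bundle of 2-forms as a tensor field with two upper and two
lower indices, antisymmetric in both pairs: `(A η)_{ij} = ∑_{k,l} A_{ij}^{kl} η_{kl}`, that is
`A_{ij}^{kl} = 1/2 (A (dx^k ∧ dx^l))_{ij}`. -/
def endTensor {E ι : Type*} [DecidableEq ι] (A : E → ℝ → Matrix ι ι ℝ → Matrix ι ι ℝ) :
    TensorField E ι 2 2 :=
  fun y t J I => (1 / 2) * A y t (wedge (J 0) (J 1)) (I 0) (I 1)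

/-- The tensor field `𝒫`. -/
def calP {E ι : Type*} [Fintype ι] [DecidableEq ι] (Ph Pc : E → ℝ → Matrix ι ι ℝ) :
    TensorField E ι 2 2 :=
  endTensor fun y t => mixOp (Ph y t) (Pc y t)

/-- The tensor field `ℛ = Rm ∘ 𝒫`. -/
def calR {E ι : Type*} [NormedAddCommGroup E] [NormedSpace ℝ E] [Fintype ι] [DecidableEq ι]
    (b : Module.Basis ι ℝ E) (G Ph Pc : E → ℝ → Matrix ι ι ℝ) : TensorField E ι 2 2 :=
  endTensor fun y t => curvOp b G y t ∘ mixOp (Ph y t) (Pc y t)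

/-! ### Passing from the manifold to a chart

`N` is a manifold with model `I`, `e` a chart of `N`, and `e.extend I` the corresponding
coordinate map to the vector space `E`. -/

section Chart

variable {E : Type*} [NormedAddCommGroup E] [NormedSpace ℝ E]
  {H : Type*} [TopologicalSpace H] (I : ModelWithCorners ℝ E H)
  {N : Type*} [TopologicalSpace N] [ChartedSpace H N]
  {ι : Type*}

/-- The coordinate vector with components `v`, a tangent vector at the point with
coordinates `y`. -/
def coordVec (e : OpenPartialHomeomorph N H) (y v : E) :
    TangentSpace I ((e.extend I).symm y) :=
  mfderiv 𝓘(ℝ, E) I (e.extend I).symm y v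

/-- The components in the chart `e` of a family of endomorphisms of the tangent bundle: the entry
in row `k` and column `i` is the `k`-th coordinate of `P ∂_i`. -/
def endComp (b : Module.Basis ι ℝ E)
    (P : ℝ → (x : N) → TangentSpace I x →L[ℝ] TangentSpace I x)
    (e : OpenPartialHomeomorph N H) (y : E) (t : ℝ) : Matrix ι ι ℝ :=
  Matrix.of fun k i =>
    b.repr (mfderiv I 𝓘(ℝ, E) (e.extend I) ((e.extend I).symm y)
      (P t ((e.extend I).symm y) (coordVec I e y (b i)))) k

variable [IsManifold I ∞ N]

/-- The components `g_{ij} = g(∂_i, ∂_j)` in the chart `e` of a family of Riemannian metrics. -/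
def metricComp (b : Module.Basis ι ℝ E)
    (g : ℝ → ContMDiffRiemannianMetric I ∞ E (fun x : N => TangentSpace I x))
    (e : OpenPartialHomeomorph N H) (y : E) (t : ℝ) : Matrix ι ι ℝ :=
  Matrix.of fun i j =>
    (g t).inner ((e.extend I).symm y) (coordVec I e y (b i)) (coordVec I e y (b j))

variable [Fintype ι] [DecidableEq ι]

/-- `g(t)`, `t ∈ [0, T]`, is a smooth solution of the Ricci flow `∂_t g = -2 Rc` on
`N × [0, T]`: it is smooth as a map on `N × [0, T]` (up to the ends of the time interval), and the
equation holds in every smooth chart. -/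
structure IsSmoothRicciFlow (b : Module.Basis ι ℝ E) (T : ℝ)
    (g : ℝ → ContMDiffRiemannianMetric I ∞ E (fun x : N => TangentSpace I x)) : Prop where
  smooth : ContMDiffOn (I.prod 𝓘(ℝ, ℝ)) (I.prod 𝓘(ℝ, E →L[ℝ] E →L[ℝ] ℝ)) ∞
    (fun z : N × ℝ => TotalSpace.mk' (E →L[ℝ] E →L[ℝ] ℝ)
      (E := fun x : N => TangentSpace I x →L[ℝ] TangentSpace I x →L[ℝ] ℝ)
      z.1 ((g z.2).inner z.1))
    (Set.univ ×ˢ Set.Icc 0 T)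
  flow : ∀ e ∈ IsManifold.maximalAtlas I ∞ N, ∀ y ∈ (e.extend I).target, ∀ t ∈ Set.Icc 0 T,
    ∀ i j, HasDerivWithinAt (fun s => metricComp I b g e y s i j)
      (-2 * ricci b (metricComp I b g e) y t i j) (Set.Icc 0 T) t

/-- The family `P` of endomorphisms of the tangent bundle solves the fibrewise ODE
`∂_t P = Rc ∘ P - P ∘ Rc` on `[0, T]`. -/
def SolvesProjectionODE (b : Module.Basis ι ℝ E) (T : ℝ)
    (g : ℝ → ContMDiffRiemannianMetric I ∞ E (fun x : N => TangentSpace I x))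
    (P : ℝ → (x : N) → TangentSpace I x →L[ℝ] TangentSpace I x) : Prop :=
  ∀ e ∈ IsManifold.maximalAtlas I ∞ N, ∀ y ∈ (e.extend I).target, ∀ t ∈ Set.Icc 0 T,
    ∀ i j, HasDerivWithinAt (fun s => endComp I b P e y s i j)
      ((ricciEnd b (metricComp I b g e) y t * endComp I b P e y t
        - endComp I b P e y t * ricciEnd b (metricComp I b g e) y t) i j) (Set.Icc 0 T) t

end Chart

/-- `P` is the orthogonal projection onto the subspace `K` with respect to the bilinear form `B`. -/
def IsOrthProj {V : Type*} [AddCommGroup V] [Module ℝ V] [TopologicalSpace V]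
    (B : V →L[ℝ] V →L[ℝ] ℝ) (K : Submodule ℝ V) (P : V →L[ℝ] V) : Prop :=
  ∀ v, P v ∈ K ∧ ∀ w ∈ K, B (v - P v) w = 0

/-- The standard basis of `ℝ^m × ℝ^n`. -/
def stdBasis (m n : ℕ) :
    Module.Basis (Fin m ⊕ Fin n) ℝ (EuclideanSpace ℝ (Fin m) × EuclideanSpace ℝ (Fin n)) :=
  (EuclideanSpace.basisFun (Fin m) ℝ).toBasis.prod (EuclideanSpace.basisFun (Fin n) ℝ).toBasis

end RicciProduct

end

open RicciProduct

/-! Fix a product chart and sort the coordinate indices by factor. At time zero the metric splits: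
components with indices from both factors vanish, and components of one factor do not depend on the
coordinates of the other. Uniqueness of the flow, which would make `g(t)` a product, is not used;
only the Taylor coefficients in time at `t = 0` matter, and these are determined by the equation.

Splitting up to order `k` in time at `t = 0` (`SplitTo`) is inherited by everything built from the
metric by inversion, spatial derivatives and contractions. The decisive rule is `SplitTo.mul`: a
product whose two factors share an index can be mixed only if one factor is. Hence the Ricci tensor
splits to order `k` if the metric does, and `∂_t g = -2 Rc` raises the order of the metric to `k +
1` (`SplitTo.of_flow`). The same induction on the projection equation shows that the projections
differ from the constant factor projections by functions all of whose time derivatives vanish at `t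
= 0` (`Flat.of_projectionODE`).

Every term of `ℛ` then contains a flat factor: the mixed projection keeps only 2-forms with one
index in each factor, and curvature components with such a pair are flat (`TensorFlat.calR`). Up to
flat terms `∇𝒫` is the action of the connection matrix on a constant tensor, which involves only the
block of that matrix between the two factors (`TensorFlat.nabla_calP`). Finally `∇` and `D_t` have
smooth coefficients and preserve flatness, so the iterated derivatives vanish at `t = 0`.

The projections are given fibre by fibre only, so their smoothness in space has to be proved. It
follows from smooth dependence on parameters for linear equations on a closed time interval
(`contDiffOn_linearODE_solution`). -/

namespace RicciProduct

open Set

/-! ### Calculus on `U × [0, T]`, up to the ends of the time interval. -/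

section Calculus

set_option linter.unusedSectionVars false

variable {E : Type*} [NormedAddCommGroup E] [NormedSpace ℝ E]

/-- Smoothness of a time-dependent function on `U × [0, T]`, up to the ends of the interval. -/
def SmoothOn (U : Set E) (T : ℝ) (f : E → ℝ → ℝ) : Prop :=
  ContDiffOn ℝ ∞ (fun p : E × ℝ => f p.1 p.2) (U ×ˢ Icc 0 T)

/-- The time derivative within `[0, T]`. -/
noncomputable def dt (T : ℝ) (f : E → ℝ → ℝ) : E → ℝ → ℝ :=
  fun y t => derivWithin (f y) (Icc 0 T) t

/-- The spatial derivative in the direction `v`. -/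
noncomputable def dx (v : E) (f : E → ℝ → ℝ) : E → ℝ → ℝ :=
  fun y t => fderiv ℝ (fun z => f z t) y v

/-- Equality on `U × [0, T]`. -/
def EqOnST (U : Set E) (T : ℝ) (f h : E → ℝ → ℝ) : Prop :=
  ∀ y ∈ U, ∀ t ∈ Icc 0 T, f y t = h y t

variable {U : Set E} {T : ℝ}

theorem EqOnST.symm {f h : E → ℝ → ℝ} (H : EqOnST U T f h) : EqOnST U T h f :=
  fun y hy t ht => (H y hy t ht).symm

theorem EqOnST.trans {f h w : E → ℝ → ℝ} (H : EqOnST U T f h) (H' : EqOnST U T h w) :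
    EqOnST U T f w :=
  fun y hy t ht => (H y hy t ht).trans (H' y hy t ht)

theorem EqOnST.dt {f h : E → ℝ → ℝ} (H : EqOnST U T f h) :
    EqOnST U T (dt T f) (dt T h) :=
  fun y hy t ht => derivWithin_congr (fun s hs => H y hy s hs) (H y hy t ht)

theorem EqOnST.dx {f h : E → ℝ → ℝ} (hU : IsOpen U) (H : EqOnST U T f h) (v : E) :
    EqOnST U T (dx v f) (dx v h) := by
  intro y hy t ht
  have : (fun z => f z t) =ᶠ[nhds y] fun z => h z t := by
    filter_upwards [hU.mem_nhds hy] with z hz using H z hz t ht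
  simp only [RicciProduct.dx, this.fderiv_eq]

theorem SmoothOn.congr {f h : E → ℝ → ℝ} (hf : SmoothOn U T f) (H : EqOnST U T h f) :
    SmoothOn U T h :=
  ContDiffOn.congr hf fun p hp => H p.1 hp.1 p.2 hp.2

theorem SmoothOn.const (c : ℝ) : SmoothOn U T (fun _ _ => c) := contDiffOn_const

theorem SmoothOn.add {f h : E → ℝ → ℝ} (hf : SmoothOn U T f) (hh : SmoothOn U T h) :
    SmoothOn U T (fun y t => f y t + h y t) := ContDiffOn.add hf hh

theorem SmoothOn.sub {f h : E → ℝ → ℝ} (hf : SmoothOn U T f) (hh : SmoothOn U T h) :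
    SmoothOn U T (fun y t => f y t - h y t) := ContDiffOn.sub hf hh

theorem SmoothOn.mul {f h : E → ℝ → ℝ} (hf : SmoothOn U T f) (hh : SmoothOn U T h) :
    SmoothOn U T (fun y t => f y t * h y t) := ContDiffOn.mul hf hh

theorem SmoothOn.sum {α : Type*} {s : Finset α} {f : α → E → ℝ → ℝ}
    (hf : ∀ a ∈ s, SmoothOn U T (f a)) : SmoothOn U T (fun y t => ∑ a ∈ s, f a y t) :=
  ContDiffOn.sum hf

theorem SmoothOn.prod {α : Type*} {s : Finset α} {f : α → E → ℝ → ℝ}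
    (hf : ∀ a ∈ s, SmoothOn U T (f a)) : SmoothOn U T (fun y t => ∏ a ∈ s, f a y t) :=
  contDiffOn_prod hf

theorem uniqueDiffOn_ST (hU : IsOpen U) (hT : 0 < T) : UniqueDiffOn ℝ (U ×ˢ Icc (0 : ℝ) T) :=
  hU.uniqueDiffOn.prod (uniqueDiffOn_Icc hT)

theorem SmoothOn.hasFDerivWithinAt {f : E → ℝ → ℝ} (hf : SmoothOn U T f) {y : E} (hy : y ∈ U)
    {t : ℝ} (ht : t ∈ Icc 0 T) :
    HasFDerivWithinAt (fun p : E × ℝ => f p.1 p.2)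
      (fderivWithin ℝ (fun p : E × ℝ => f p.1 p.2) (U ×ˢ Icc 0 T) (y, t)) (U ×ˢ Icc 0 T) (y, t) :=
  ((hf (y, t) ⟨hy, ht⟩).differentiableWithinAt (by simp)).hasFDerivWithinAt

theorem SmoothOn.hasFDerivAt_space {f : E → ℝ → ℝ} (hU : IsOpen U) (hf : SmoothOn U T f)
    {y : E} (hy : y ∈ U) {t : ℝ} (ht : t ∈ Icc 0 T) :
    HasFDerivAt (fun z => f z t)
      ((fderivWithin ℝ (fun p : E × ℝ => f p.1 p.2) (U ×ˢ Icc 0 T) (y, t)).comp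
        (ContinuousLinearMap.inl ℝ E ℝ)) y := by
  have h1 : HasFDerivWithinAt (fun z : E => (z, t)) (ContinuousLinearMap.inl ℝ E ℝ) U y := by
    simpa using (hasFDerivAt_prodMk_left (𝕜 := ℝ) y t).hasFDerivWithinAt
  have := (hf.hasFDerivWithinAt hy ht).comp y h1 (fun z hz => (⟨hz, ht⟩ : (z, t) ∈ U ×ˢ Icc 0 T))
  exact this.hasFDerivAt (hU.mem_nhds hy)

theorem SmoothOn.hasDerivWithinAt_time {f : E → ℝ → ℝ} (hf : SmoothOn U T f)
    {y : E} (hy : y ∈ U) {t : ℝ} (ht : t ∈ Icc 0 T) :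
    HasDerivWithinAt (f y)
      (fderivWithin ℝ (fun p : E × ℝ => f p.1 p.2) (U ×ˢ Icc 0 T) (y, t) (0, 1)) (Icc 0 T) t := by
  have h1 : HasDerivWithinAt (fun s : ℝ => (y, s)) ((0 : E), (1 : ℝ)) (Icc 0 T) t :=
    (hasDerivWithinAt_const t (Icc 0 T) y).prodMk (hasDerivWithinAt_id t (Icc 0 T))
  exact (hf.hasFDerivWithinAt hy ht).comp_hasDerivWithinAt t h1 (fun s hs => ⟨hy, hs⟩)

theorem SmoothOn.dx_eq {f : E → ℝ → ℝ} (hU : IsOpen U) (hf : SmoothOn U T f) (v : E) :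
    EqOnST U T (dx v f) (fun y t =>
      fderivWithin ℝ (fun p : E × ℝ => f p.1 p.2) (U ×ˢ Icc 0 T) (y, t) (v, 0)) := by
  intro y hy t ht
  simp [RicciProduct.dx, (hf.hasFDerivAt_space hU hy ht).fderiv]

theorem SmoothOn.dt_eq {f : E → ℝ → ℝ} (hT : 0 < T) (hf : SmoothOn U T f) :
    EqOnST U T (dt T f) (fun y t =>
      fderivWithin ℝ (fun p : E × ℝ => f p.1 p.2) (U ×ˢ Icc 0 T) (y, t) (0, 1)) :=
  fun _ hy t ht => (hf.hasDerivWithinAt_time hy ht).derivWithin (uniqueDiffOn_Icc hT t ht)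

theorem SmoothOn.fderivWithin_apply {f : E → ℝ → ℝ} (hU : IsOpen U) (hT : 0 < T)
    (hf : SmoothOn U T f) (w : E × ℝ) : SmoothOn U T (fun y t =>
      fderivWithin ℝ (fun p : E × ℝ => f p.1 p.2) (U ×ˢ Icc 0 T) (y, t) w) :=
  (ContDiffOn.fderivWithin hf (uniqueDiffOn_ST hU hT) (m := ∞) (by simp)).clm_apply
    contDiffOn_const

theorem SmoothOn.dx {f : E → ℝ → ℝ} (hU : IsOpen U) (hT : 0 < T) (hf : SmoothOn U T f) (v : E) :
    SmoothOn U T (dx v f) :=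
  (hf.fderivWithin_apply hU hT (v, 0)).congr (hf.dx_eq hU v)

theorem SmoothOn.dt {f : E → ℝ → ℝ} (hU : IsOpen U) (hT : 0 < T) (hf : SmoothOn U T f) :
    SmoothOn U T (dt T f) :=
  (hf.fderivWithin_apply hU hT (0, 1)).congr (hf.dt_eq hT)

theorem SmoothOn.fderivWithin_fderivWithin_comm {f : E → ℝ → ℝ} (hU : IsOpen U) (hT : 0 < T)
    (hf : SmoothOn U T f) (v w : E × ℝ) {p : E × ℝ} (hp : p ∈ U ×ˢ Icc 0 T) :
    fderivWithin ℝ (fun q => fderivWithin ℝ (fun p : E × ℝ => f p.1 p.2) (U ×ˢ Icc 0 T) q v)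
      (U ×ˢ Icc 0 T) p w =
    fderivWithin ℝ (fun q => fderivWithin ℝ (fun p : E × ℝ => f p.1 p.2) (U ×ˢ Icc 0 T) q w)
      (U ×ˢ Icc 0 T) p v := by
  have huniq := uniqueDiffOn_ST hU hT
  have hd : DifferentiableWithinAt ℝ
      (fderivWithin ℝ (fun p : E × ℝ => f p.1 p.2) (U ×ˢ Icc 0 T)) (U ×ˢ Icc 0 T) p :=
    (ContDiffOn.fderivWithin hf huniq (m := ∞) (by simp)).differentiableOn (by simp) p hp
  have key : ∀ v : E × ℝ, fderivWithin ℝ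
      (fun q => fderivWithin ℝ (fun p : E × ℝ => f p.1 p.2) (U ×ˢ Icc 0 T) q v)
      (U ×ˢ Icc 0 T) p =
      (fderivWithin ℝ (fderivWithin ℝ (fun p : E × ℝ => f p.1 p.2) (U ×ˢ Icc 0 T))
        (U ×ˢ Icc 0 T) p).flip v := by
    intro v
    rw [fderivWithin_clm_apply (huniq p hp) hd (differentiableWithinAt_const v)]
    simp
  rw [key, key]
  -- At the ends of the time interval `p` is a boundary point; symmetry of the second derivative
  -- still holds there because `p` is a limit of interior points.
  have hcl : p ∈ closure (interior (U ×ˢ Icc (0 : ℝ) T)) := by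
    rw [interior_prod_eq, hU.interior_eq, interior_Icc, closure_prod_eq, closure_Ioo hT.ne]
    exact ⟨subset_closure hp.1, hp.2⟩
  have := ContDiffWithinAt.isSymmSndFDerivWithinAt (n := ∞) (hf p hp)
    (by simpa using WithTop.coe_le_coe.2 (le_top : (2 : ℕ∞) ≤ ⊤)) huniq hcl hp
  exact this w v

/-- This carries inductions on the order in time through spatial derivatives, also at time zero,
where the time derivative is one-sided. -/
theorem SmoothOn.dt_dx_comm {f : E → ℝ → ℝ} (hU : IsOpen U) (hT : 0 < T) (hf : SmoothOn U T f)
    (v : E) :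
    EqOnST U T (RicciProduct.dt T (RicciProduct.dx v f))
      (RicciProduct.dx v (RicciProduct.dt T f)) := by
  have h1 := (hf.dx_eq hU v).dt.trans ((hf.fderivWithin_apply hU hT (v, 0)).dt_eq hT)
  have h2 := ((hf.dt_eq hT).dx hU v).trans ((hf.fderivWithin_apply hU hT (0, 1)).dx_eq hU v)
  intro y hy t ht
  rw [h1 y hy t ht, h2 y hy t ht]
  exact hf.fderivWithin_fderivWithin_comm hU hT _ _ ⟨hy, ht⟩

theorem SmoothOn.dx_dx_comm {f : E → ℝ → ℝ} (hU : IsOpen U) (hT : 0 < T) (hf : SmoothOn U T f)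
    (v w : E) :
    EqOnST U T (RicciProduct.dx w (RicciProduct.dx v f))
      (RicciProduct.dx v (RicciProduct.dx w f)) := by
  have h1 := ((hf.dx_eq hU v).dx hU w).trans ((hf.fderivWithin_apply hU hT (v, 0)).dx_eq hU w)
  have h2 := ((hf.dx_eq hU w).dx hU v).trans ((hf.fderivWithin_apply hU hT (w, 0)).dx_eq hU v)
  intro y hy t ht
  rw [h1 y hy t ht, h2 y hy t ht]
  exact hf.fderivWithin_fderivWithin_comm hU hT _ _ ⟨hy, ht⟩

theorem SmoothOn.differentiableAt {f : E → ℝ → ℝ} (hU : IsOpen U) (hf : SmoothOn U T f)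
    {y : E} (hy : y ∈ U) {t : ℝ} (ht : t ∈ Icc 0 T) : DifferentiableAt ℝ (fun z => f z t) y :=
  (hf.hasFDerivAt_space hU hy ht).differentiableAt

theorem dx_add {f h : E → ℝ → ℝ} (hU : IsOpen U) (hf : SmoothOn U T f) (hh : SmoothOn U T h)
    (v : E) : EqOnST U T (dx v (fun y t => f y t + h y t)) (fun y t => dx v f y t + dx v h y t) := by
  intro y hy t ht
  simp only [dx]
  rw [fderiv_fun_add (hf.differentiableAt hU hy ht) (hh.differentiableAt hU hy ht)]
  rfl

theorem dx_sum {α : Type*} {s : Finset α} {f : α → E → ℝ → ℝ} (hU : IsOpen U)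
    (hf : ∀ a ∈ s, SmoothOn U T (f a)) (v : E) :
    EqOnST U T (dx v (fun y t => ∑ a ∈ s, f a y t)) (fun y t => ∑ a ∈ s, dx v (f a) y t) := by
  intro y hy t ht
  simp only [dx]
  rw [fderiv_fun_sum (fun a ha => (hf a ha).differentiableAt hU hy ht)]
  simp

theorem dx_mul {f h : E → ℝ → ℝ} (hU : IsOpen U) (hf : SmoothOn U T f) (hh : SmoothOn U T h)
    (v : E) : EqOnST U T (dx v (fun y t => f y t * h y t))
      (fun y t => dx v f y t * h y t + f y t * dx v h y t) := by
  intro y hy t ht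
  simp only [dx]
  rw [fderiv_fun_mul (hf.differentiableAt hU hy ht) (hh.differentiableAt hU hy ht)]
  simp
  ring

theorem SmoothOn.differentiableWithinAt {f : E → ℝ → ℝ} (hf : SmoothOn U T f)
    {y : E} (hy : y ∈ U) {t : ℝ} (ht : t ∈ Icc 0 T) :
    DifferentiableWithinAt ℝ (f y) (Icc 0 T) t :=
  (hf.hasDerivWithinAt_time hy ht).differentiableWithinAt

theorem dt_add {f h : E → ℝ → ℝ} (hf : SmoothOn U T f) (hh : SmoothOn U T h) :
    EqOnST U T (dt T (fun y t => f y t + h y t)) (fun y t => dt T f y t + dt T h y t) :=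
  fun _ hy _ ht =>
    derivWithin_fun_add (hf.differentiableWithinAt hy ht) (hh.differentiableWithinAt hy ht)

theorem dt_mul {f h : E → ℝ → ℝ} (hf : SmoothOn U T f) (hh : SmoothOn U T h) :
    EqOnST U T (dt T (fun y t => f y t * h y t))
      (fun y t => dt T f y t * h y t + f y t * dt T h y t) :=
  fun _ hy _ ht =>
    derivWithin_fun_mul (hf.differentiableWithinAt hy ht) (hh.differentiableWithinAt hy ht)

/-! ### Vanishing to finite order in time at time zero. -/

/-- `f` is smooth on `U × [0, T]` and its time derivatives of order at most `k` vanish at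
time zero. -/
def VanishTo (U : Set E) (T : ℝ) : ℕ → (E → ℝ → ℝ) → Prop
  | 0, f => SmoothOn U T f ∧ ∀ y ∈ U, f y 0 = 0
  | k + 1, f => (SmoothOn U T f ∧ ∀ y ∈ U, f y 0 = 0) ∧ VanishTo U T k (dt T f)

theorem VanishTo.of_succ {k : ℕ} {f : E → ℝ → ℝ} (hf : VanishTo U T (k + 1) f) :
    VanishTo U T k f := by
  induction k generalizing f with
  | zero => exact hf.1
  | succ k ih => exact ⟨hf.1, ih hf.2⟩

theorem VanishTo.congr (hT : 0 ≤ T) {k : ℕ} {f h : E → ℝ → ℝ} (hf : VanishTo U T k f)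
    (H : EqOnST U T h f) : VanishTo U T k h := by
  induction k generalizing f h with
  | zero => exact ⟨hf.1.congr H, fun y hy => (H y hy 0 ⟨le_rfl, hT⟩).trans (hf.2 y hy)⟩
  | succ k ih =>
    exact ⟨⟨hf.1.1.congr H, fun y hy => (H y hy 0 ⟨le_rfl, hT⟩).trans (hf.1.2 y hy)⟩,
      ih hf.2 H.dt⟩

theorem VanishTo.add (hT : 0 ≤ T) {k : ℕ} {f h : E → ℝ → ℝ} (hf : VanishTo U T k f)
    (hh : VanishTo U T k h) : VanishTo U T k (fun y t => f y t + h y t) := by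
  induction k generalizing f h with
  | zero => exact ⟨hf.1.add hh.1, fun y hy => by simp [hf.2 y hy, hh.2 y hy]⟩
  | succ k ih =>
    exact ⟨⟨hf.1.1.add hh.1.1, fun y hy => by simp [hf.1.2 y hy, hh.1.2 y hy]⟩,
      (ih hf.2 hh.2).congr hT (dt_add hf.1.1 hh.1.1)⟩

/-- Leibniz rule: both terms of the time derivative need only order `k`, so where the derivative
falls on `h`, one order of `f` is given away. -/
theorem VanishTo.mul_right (hU : IsOpen U) (hT : 0 < T) {k : ℕ} {f h : E → ℝ → ℝ}
    (hf : VanishTo U T k f) (hh : SmoothOn U T h) :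
    VanishTo U T k (fun y t => f y t * h y t) := by
  induction k generalizing f h with
  | zero => exact ⟨hf.1.mul hh, fun y hy => by simp [hf.2 y hy]⟩
  | succ k ih =>
    exact ⟨⟨hf.1.1.mul hh, fun y hy => by simp [hf.1.2 y hy]⟩,
      ((ih hf.2 hh).add hT.le (ih hf.of_succ (hh.dt hU hT))).congr hT.le (dt_mul hf.1.1 hh)⟩

theorem VanishTo.mul_left (hU : IsOpen U) (hT : 0 < T) {k : ℕ} {f h : E → ℝ → ℝ}
    (hh : SmoothOn U T h) (hf : VanishTo U T k f) :
    VanishTo U T k (fun y t => h y t * f y t) :=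
  (hf.mul_right hU hT hh).congr hT.le fun _ _ _ _ => mul_comm _ _

theorem VanishTo.sub (hU : IsOpen U) (hT : 0 < T) {k : ℕ} {f h : E → ℝ → ℝ}
    (hf : VanishTo U T k f) (hh : VanishTo U T k h) :
    VanishTo U T k (fun y t => f y t - h y t) :=
  (hf.add hT.le (hh.mul_left hU hT (SmoothOn.const (-1)))).congr hT.le
    fun _ _ _ _ => by ring

theorem vanishTo_zero_fun (k : ℕ) : VanishTo U T k (fun _ _ => 0) := by
  induction k with
  | zero => exact ⟨SmoothOn.const 0, fun _ _ => rfl⟩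
  | succ k ih =>
    refine ⟨⟨SmoothOn.const 0, fun _ _ => rfl⟩, ?_⟩
    have : dt T (fun (_ : E) _ => 0) = fun _ _ => 0 := by ext; simp [dt]
    rwa [this]

theorem VanishTo.sum (hT : 0 ≤ T) {k : ℕ} {α : Type*} {s : Finset α} {f : α → E → ℝ → ℝ}
    (hf : ∀ a ∈ s, VanishTo U T k (f a)) : VanishTo U T k (fun y t => ∑ a ∈ s, f a y t) := by
  classical
  induction s using Finset.induction_on with
  | empty => simpa using vanishTo_zero_fun k
  | insert a s ha ih =>
    simp only [Finset.sum_insert ha]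
    exact (hf a (by simp)).add hT (ih fun c hc => hf c (by simp [hc]))

/-- No order is lost: a function that is zero on the whole open set `U` at time zero has zero
spatial derivatives there, and time derivatives commute with `dx`. This is why vanishing is required
on `U` and not at a single point. -/
theorem VanishTo.dx (hU : IsOpen U) (hT : 0 < T) {k : ℕ} {f : E → ℝ → ℝ}
    (hf : VanishTo U T k f) (v : E) : VanishTo U T k (dx v f) := by
  have base : ∀ {f : E → ℝ → ℝ}, VanishTo U T 0 f → VanishTo U T 0 (RicciProduct.dx v f) := by
    intro f hf
    refine ⟨hf.1.dx hU hT v, fun y hy => ?_⟩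
    have : (fun z => f z 0) =ᶠ[nhds y] fun _ => 0 := by
      filter_upwards [hU.mem_nhds hy] with z hz using hf.2 z hz
    simp [RicciProduct.dx, this.fderiv_eq]
  induction k generalizing f with
  | zero => exact base hf
  | succ k ih => exact ⟨base hf.1, (ih hf.2).congr hT.le (hf.1.1.dt_dx_comm hU hT v)⟩

end Calculus

/-! ### Functions that behave like components of a direct sum of tensors. -/

section Split

set_option linter.unusedSectionVars false

variable {E : Type*} [NormedAddCommGroup E] [NormedSpace ℝ E] {ι : Type*}

/-- All indices of the list `L` belong to the same factor; `τ` tells to which factor an index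
belongs. -/
def Homogeneous (τ : ι → Bool) (L : List ι) : Prop :=
  ∀ a ∈ L, ∀ c ∈ L, τ a = τ c

/-- Up to order `k` in time at time zero, `f` behaves like a component with indices `L` of a
direct sum of tensor fields on the two factors: it vanishes if the indices are mixed, and depends
on the coordinates of the corresponding factor only. -/
structure SplitTo (U : Set E) (T : ℝ) (b : Module.Basis ι ℝ E) (τ : ι → Bool) (k : ℕ)
    (L : List ι) (f : E → ℝ → ℝ) : Prop where
  smooth : SmoothOn U T f
  vanish : ¬ Homogeneous τ L → VanishTo U T k f
  deriv : ∀ a, ¬ Homogeneous τ (a :: L) → VanishTo U T k (dx (b a) f)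

variable {U : Set E} {T : ℝ} {b : Module.Basis ι ℝ E} {τ : ι → Bool} {k : ℕ}

theorem Homogeneous.mono {L L' : List ι} (h : Homogeneous τ L) (hL : L' ⊆ L) :
    Homogeneous τ L' :=
  fun a ha c hc => h a (hL ha) c (hL hc)

theorem SplitTo.congr (hU : IsOpen U) (hT : 0 ≤ T) {L : List ι} {f h : E → ℝ → ℝ}
    (hf : SplitTo U T b τ k L f) (H : EqOnST U T h f) : SplitTo U T b τ k L h :=
  ⟨hf.smooth.congr H, fun hL => (hf.vanish hL).congr hT H,
    fun a ha => (hf.deriv a ha).congr hT (H.dx hU _)⟩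

/-- A list that contains a mixed list is mixed. This is what discards summation indices after a
contraction. -/
theorem SplitTo.mono {L L' : List ι} {f : E → ℝ → ℝ} (hf : SplitTo U T b τ k L f) (hL : L' ⊆ L) :
    SplitTo U T b τ k L' f :=
  ⟨hf.smooth, fun h => hf.vanish fun h' => h (h'.mono hL), fun a h => hf.deriv a fun h' =>
    h (h'.mono (List.cons_subset_cons a hL))⟩

theorem SplitTo.add (hU : IsOpen U) (hT : 0 < T) {L : List ι} {f h : E → ℝ → ℝ}
    (hf : SplitTo U T b τ k L f) (hh : SplitTo U T b τ k L h) :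
    SplitTo U T b τ k L (fun y t => f y t + h y t) :=
  ⟨hf.smooth.add hh.smooth, fun hL => (hf.vanish hL).add hT.le (hh.vanish hL),
    fun a ha => ((hf.deriv a ha).add hT.le (hh.deriv a ha)).congr hT.le
      (dx_add hU hf.smooth hh.smooth _)⟩

theorem SplitTo.sum (hU : IsOpen U) (hT : 0 < T) {L : List ι} {α : Type*} {s : Finset α}
    {f : α → E → ℝ → ℝ} (hf : ∀ a ∈ s, SplitTo U T b τ k L (f a)) :
    SplitTo U T b τ k L (fun y t => ∑ a ∈ s, f a y t) :=
  ⟨SmoothOn.sum fun a ha => (hf a ha).smooth,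
    fun hL => VanishTo.sum hT.le fun a ha => (hf a ha).vanish hL,
    fun c hc => (VanishTo.sum hT.le fun a ha => (hf a ha).deriv c hc).congr hT.le
      (dx_sum hU (fun a ha => (hf a ha).smooth) _)⟩

/-- The common index `c` ties the two lists together: if both are homogeneous, so is their
concatenation. Thus a mixed concatenation forces one factor to be mixed, and the same holds with an
index of differentiation adjoined to either list. -/
theorem SplitTo.mul (hU : IsOpen U) (hT : 0 < T) {L L' : List ι} {f h : E → ℝ → ℝ}
    (hf : SplitTo U T b τ k L f) (hh : SplitTo U T b τ k L' h) {c : ι} (hc : c ∈ L)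
    (hc' : c ∈ L') :
    SplitTo U T b τ k (L ++ L') (fun y t => f y t * h y t) := by
  have key : ∀ {L L' : List ι} {c : ι}, c ∈ L → c ∈ L' → Homogeneous τ L → Homogeneous τ L' →
      Homogeneous τ (L ++ L') := by
    intro L L' c hc hc' h1 h2 a ha d hd
    have : ∀ a ∈ L ++ L', τ a = τ c := by
      intro a ha
      rcases List.mem_append.1 ha with ha | ha
      · exact h1 a ha c hc
      · exact h2 a ha c hc'
    rw [this a ha, this d hd]
  refine ⟨hf.smooth.mul hh.smooth, fun hL => ?_, fun a ha => ?_⟩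
  · by_cases h1 : Homogeneous τ L
    · have h2 : ¬ Homogeneous τ L' := fun h2 => hL (key hc hc' h1 h2)
      exact (hh.vanish h2).mul_left hU hT hf.smooth
    · exact (hf.vanish h1).mul_right hU hT hh.smooth
  · refine VanishTo.congr hT.le (VanishTo.add hT.le ?_ ?_) (dx_mul hU hf.smooth hh.smooth _)
    · by_cases h1 : Homogeneous τ (a :: L)
      · have h2 : ¬ Homogeneous τ L' := fun h2 =>
          ha (key (L := a :: L) (List.mem_cons_of_mem _ hc) hc' h1 h2)
        exact (hh.vanish h2).mul_left hU hT (hf.smooth.dx hU hT _)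
      · exact (hf.deriv a h1).mul_right hU hT hh.smooth
    · by_cases h1 : Homogeneous τ L
      · have h2 : ¬ Homogeneous τ (a :: L') := fun h2 =>
          ha ((key hc (List.mem_cons_of_mem a hc') h1 h2).mono (by
            intro x hx; simp at hx ⊢; tauto))
        exact (hh.deriv a h2).mul_left hU hT hf.smooth
      · exact (hf.vanish h1).mul_right hU hT (hh.smooth.dx hU hT _)

theorem SplitTo.const_mul (hU : IsOpen U) (hT : 0 < T) {L : List ι} {f : E → ℝ → ℝ}
    (hf : SplitTo U T b τ k L f) (c : ℝ) : SplitTo U T b τ k L (fun y t => c * f y t) := by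
  have hc := SmoothOn.const (U := U) (T := T) c
  refine ⟨hc.mul hf.smooth, fun hL => (hf.vanish hL).mul_left hU hT hc, fun a ha => ?_⟩
  refine ((hf.deriv a ha).mul_left hU hT hc).congr hT.le fun y hy t ht => ?_
  rw [dx_mul hU hc hf.smooth _ y hy t ht]
  simp [RicciProduct.dx]

theorem SplitTo.sub (hU : IsOpen U) (hT : 0 < T) {L : List ι} {f h : E → ℝ → ℝ}
    (hf : SplitTo U T b τ k L f) (hh : SplitTo U T b τ k L h) :
    SplitTo U T b τ k L (fun y t => f y t - h y t) :=
  (hf.add hU hT (hh.const_mul hU hT (-1))).congr hU hT.le fun _ _ _ _ => by ring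

/-- If `a :: L` is homogeneous and `c` lies in the other factor, then `c :: L` is already mixed, so
`∂_c f` vanishes and the derivatives can be interchanged. An empty `L` would not see the factor of
`c`. -/
theorem SplitTo.dx (hU : IsOpen U) (hT : 0 < T) {L : List ι} (hL : L ≠ []) {f : E → ℝ → ℝ}
    (hf : SplitTo U T b τ k L f) (a : ι) : SplitTo U T b τ k (a :: L) (dx (b a) f) := by
  refine ⟨hf.smooth.dx hU hT _, fun h => hf.deriv a h, fun c hc => ?_⟩
  by_cases h : Homogeneous τ (a :: L)
  · have h' : ¬ Homogeneous τ (c :: L) := by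
      obtain ⟨x, hx⟩ := List.exists_mem_of_ne_nil L hL
      intro h'
      refine hc fun u hu v hv => ?_
      have : ∀ u ∈ c :: a :: L, τ u = τ x := by
        intro u hu
        rcases List.mem_cons.1 hu with rfl | hu
        · exact h' u (by simp) x (by simp [hx])
        · exact h u hu x (by simp [hx])
      rw [this u hu, this v hv]
    exact ((hf.deriv c h').dx hU hT (b a)).congr hT.le (hf.smooth.dx_dx_comm hU hT _ _)
  · exact (hf.deriv a h).dx hU hT _

end Split

/-! ### Splitting of the inverse metric, the connection and the curvature. -/

section Curvature

set_option linter.unusedSectionVars false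

variable {E : Type*} [NormedAddCommGroup E] [NormedSpace ℝ E] {ι : Type*} [Fintype ι]
  [DecidableEq ι] {U : Set E} {T : ℝ} {b : Module.Basis ι ℝ E} {τ : ι → Bool} {k : ℕ}
  {G : E → ℝ → Matrix ι ι ℝ}

theorem SmoothOn.det {M : E → ℝ → Matrix ι ι ℝ}
    (hM : ∀ i j, SmoothOn U T (fun y t => M y t i j)) : SmoothOn U T (fun y t => (M y t).det) := by
  simp only [Matrix.det_apply']
  exact SmoothOn.sum fun σ _ => (SmoothOn.const _).mul (SmoothOn.prod fun i _ => hM _ _)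

theorem SmoothOn.inv {M : E → ℝ → Matrix ι ι ℝ}
    (hM : ∀ i j, SmoothOn U T (fun y t => M y t i j))
    (hdet : ∀ y ∈ U, ∀ t ∈ Icc 0 T, (M y t).det ≠ 0) (i j : ι) :
    SmoothOn U T (fun y t => (M y t)⁻¹ i j) := by
  simp only [Matrix.inv_def, Matrix.smul_apply, Matrix.adjugate_apply, Ring.inverse_eq_inv',
    smul_eq_mul]
  refine SmoothOn.mul (ContDiffOn.inv (SmoothOn.det hM) fun p hp => hdet _ hp.1 _ hp.2)
    (SmoothOn.det fun a c => ?_)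
  simp only [Matrix.updateRow_apply]
  by_cases h : a = j
  · simp only [h, if_true]; exact SmoothOn.const _
  · simp only [h, if_false]; exact hM a c

/-- The factor of an index as a number. -/
def sgn (τ : ι → Bool) (i : ι) : ℝ := if τ i then 1 else 0

theorem sgn_sub_ne_zero {i j : ι} (h : τ i ≠ τ j) : sgn τ i - sgn τ j ≠ 0 := by
  unfold sgn
  cases hi : τ i <;> cases hj : τ j <;> simp_all

theorem not_homogeneous_pair {i j : ι} (h : ¬ Homogeneous τ [i, j]) : τ i ≠ τ j := by
  intro h'
  apply h
  simp [Homogeneous, h']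

/-- With `D` the diagonal matrix of `sgn τ`, one has `G⁻¹ (D G - G D) G⁻¹ = G⁻¹ D - D G⁻¹`. The
commutator on the left involves only mixed entries of `G`, and the entry on the right is `G⁻¹ i j`
times a number that is nonzero for mixed `i, j`. -/
theorem VanishTo.inv_of_ne (hU : IsOpen U) (hT : 0 < T)
    (hG : ∀ i j, SmoothOn U T (fun y t => G y t i j))
    (hdet : ∀ y ∈ U, ∀ t ∈ Icc 0 T, (G y t).det ≠ 0)
    (hG' : ∀ i j, τ i ≠ τ j → VanishTo U T k (fun y t => G y t i j)) {i j : ι} (hij : τ i ≠ τ j) :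
    VanishTo U T k (fun y t => (G y t)⁻¹ i j) := by
  have hI := SmoothOn.inv hG hdet
  have key : VanishTo U T k (fun y t => (sgn τ j - sgn τ i)⁻¹ * ∑ c, ∑ d,
      ((G y t)⁻¹ i c * ((sgn τ c - sgn τ d) * G y t c d)) * (G y t)⁻¹ d j) := by
    refine VanishTo.mul_left hU hT (SmoothOn.const _) ?_
    refine VanishTo.sum hT.le fun c _ => VanishTo.sum hT.le fun d _ => ?_
    refine VanishTo.mul_right hU hT (VanishTo.mul_left hU hT (hI i c) ?_) (hI d j)
    by_cases h : τ c = τ d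
    · have : sgn τ c = sgn τ d := by simp [sgn, h]
      simpa [this] using vanishTo_zero_fun k
    · exact (hG' c d h).mul_left hU hT (SmoothOn.const _)
  refine key.congr hT.le fun y hy t ht => ?_
  have hu : IsUnit (G y t).det := (hdet y hy t ht).isUnit
  have h1 : (G y t)⁻¹ * (Matrix.diagonal (sgn τ) * G y t - G y t * Matrix.diagonal (sgn τ)) *
      (G y t)⁻¹ = (G y t)⁻¹ * Matrix.diagonal (sgn τ) - Matrix.diagonal (sgn τ) * (G y t)⁻¹ := by
    rw [mul_sub, sub_mul, ← mul_assoc, Matrix.mul_nonsing_inv_cancel_right _ _ hu,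
      ← mul_assoc, Matrix.nonsing_inv_mul _ hu, one_mul]
  have h2 := congrFun (congrFun h1 i) j
  rw [Matrix.sub_apply, Matrix.mul_diagonal, Matrix.diagonal_mul, Matrix.mul_apply] at h2
  have h3 : (∑ c, ∑ d, ((G y t)⁻¹ i c * ((sgn τ c - sgn τ d) * G y t c d)) * (G y t)⁻¹ d j) =
      (sgn τ j - sgn τ i) * (G y t)⁻¹ i j := by
    rw [sub_mul, mul_comm (sgn τ j), ← h2, Finset.sum_comm]
    refine Finset.sum_congr rfl fun d _ => ?_
    rw [Matrix.mul_apply, Finset.sum_mul]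
    refine Finset.sum_congr rfl fun c _ => ?_
    rw [Matrix.sub_apply, Matrix.mul_diagonal, Matrix.diagonal_mul]
    ring
  beta_reduce
  rw [h3, inv_mul_cancel_left₀ (sgn_sub_ne_zero (Ne.symm hij))]

/-- Differentiate `G⁻¹ G = 1` and multiply by `G⁻¹` from the right. -/
theorem dx_inv (hU : IsOpen U)
    (hG : ∀ i j, SmoothOn U T (fun y t => G y t i j))
    (hdet : ∀ y ∈ U, ∀ t ∈ Icc 0 T, (G y t).det ≠ 0) (i j : ι) (v : E) :
    EqOnST U T (dx v (fun y t => (G y t)⁻¹ i j)) (fun y t => -∑ d, ∑ c,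
      ((G y t)⁻¹ i c * dx v (fun y t => G y t c d) y t) * (G y t)⁻¹ d j) := by
  have hI := SmoothOn.inv hG hdet
  intro y hy t ht
  have hu : ∀ z ∈ U, IsUnit (G z t).det := fun z hz => (hdet z hz t ht).isUnit
  set D : Matrix ι ι ℝ := Matrix.of fun c d => dx v (fun y t => G y t c d) y t with hD
  set D' : Matrix ι ι ℝ := Matrix.of fun c d => dx v (fun y t => (G y t)⁻¹ c d) y t with hD'
  have h0 : D' * G y t + (G y t)⁻¹ * D = 0 := by
    ext c d
    have h1 : EqOnST U T (fun y t => ∑ e, (G y t)⁻¹ c e * G y t e d)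
        (fun _ _ => (1 : Matrix ι ι ℝ) c d) := by
      intro z hz s hs
      rw [← Matrix.nonsing_inv_mul (G z s) (hdet z hz s hs).isUnit, Matrix.mul_apply]
    have h2 := (h1.dx hU v).symm.trans (dx_sum hU (fun e _ => (hI c e).mul (hG e d)) v) y hy t ht
    have h3 : RicciProduct.dx v (fun _ _ => (1 : Matrix ι ι ℝ) c d) y t = 0 := by
      simp [RicciProduct.dx]
    rw [h3] at h2
    simp only [Matrix.add_apply, Matrix.mul_apply, Matrix.zero_apply]
    rw [h2, ← Finset.sum_add_distrib]
    refine Finset.sum_congr rfl fun e _ => ?_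
    rw [dx_mul hU (hI c e) (hG e d) v y hy t ht]
    rfl
  have h4 : D' = -((G y t)⁻¹ * D * (G y t)⁻¹) := by
    have := congrArg (· * (G y t)⁻¹) h0
    simp only [add_mul, zero_mul, Matrix.mul_nonsing_inv_cancel_right _ _ (hu y hy)] at this
    exact eq_neg_of_add_eq_zero_left this
  have h5 := congrFun (congrFun h4 i) j
  rw [Matrix.neg_apply, Matrix.mul_apply] at h5
  simp only [Matrix.mul_apply, Finset.sum_mul] at h5
  exact h5

/-- For the derivative, look at a term `G⁻¹ i c * ∂_a G c d * G⁻¹ d j`: if `a, i, j` are mixed, then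
so is one of `i, c`, or `a, c, d`, or `d, j`. -/
theorem SplitTo.inv (hU : IsOpen U) (hT : 0 < T)
    (hdet : ∀ y ∈ U, ∀ t ∈ Icc 0 T, (G y t).det ≠ 0)
    (hG : ∀ i j, SplitTo U T b τ k [i, j] (fun y t => G y t i j)) (i j : ι) :
    SplitTo U T b τ k [i, j] (fun y t => (G y t)⁻¹ i j) := by
  have hG0 : ∀ i j, SmoothOn U T (fun y t => G y t i j) := fun i j => (hG i j).smooth
  have hI := SmoothOn.inv hG0 hdet
  have hV : ∀ {i j}, τ i ≠ τ j → VanishTo U T k (fun y t => (G y t)⁻¹ i j) := fun h =>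
    VanishTo.inv_of_ne hU hT hG0 hdet
      (fun i j h => (hG i j).vanish fun h' => h (h' i (by simp) j (by simp))) h
  refine ⟨hI i j, fun h => hV (not_homogeneous_pair h), fun a ha => ?_⟩
  refine VanishTo.congr hT.le ?_ (dx_inv hU hG0 hdet i j (b a))
  have : VanishTo U T k (fun y t => 0 - ∑ d, ∑ c,
      ((G y t)⁻¹ i c * RicciProduct.dx (b a) (fun y t => G y t c d) y t) * (G y t)⁻¹ d j) := by
    refine VanishTo.sub hU hT (vanishTo_zero_fun k)
      (VanishTo.sum hT.le fun d _ => VanishTo.sum hT.le fun c _ => ?_)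
    by_cases h1 : τ i = τ c
    · by_cases h2 : τ d = τ j
      · refine VanishTo.mul_right hU hT (VanishTo.mul_left hU hT (hI i c)
          ((hG c d).deriv a fun h => ha ?_)) (hI d j)
        have e1 := h a (by simp) c (by simp)
        have e2 := h a (by simp) d (by simp)
        simp [Homogeneous, h1, ← h2, e1, ← e2]
      · exact VanishTo.mul_left hU hT ((hI i c).mul ((hG0 c d).dx hU hT _)) (hV h2)
    · exact VanishTo.mul_right hU hT (VanishTo.mul_right hU hT (hV h1) ((hG0 c d).dx hU hT _))
        (hI d j)
  simpa using this

/-- This and the curvature quantities that follow arise from split functions by derivatives, sums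
and contractions. Upper and lower indices play the same role; in each product the summation index is
the common index that `SplitTo.mul` needs, and `SplitTo.mono` then removes it. -/
theorem SplitTo.christoffel (hU : IsOpen U) (hT : 0 < T)
    (hdet : ∀ y ∈ U, ∀ t ∈ Icc 0 T, (G y t).det ≠ 0)
    (hG : ∀ i j, SplitTo U T b τ k [i, j] (fun y t => G y t i j)) (l i j : ι) :
    SplitTo U T b τ k [l, i, j] (fun y t => christoffel b G l i j y t) := by
  unfold RicciProduct.christoffel
  refine SplitTo.const_mul hU hT (SplitTo.sum hU hT fun c _ => ?_) _
  have h : SplitTo U T b τ k [i, j, c] (fun y t => pd b i (fun z => G z t j c) y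
      + pd b j (fun z => G z t i c) y - pd b c (fun z => G z t i j) y) :=
    SplitTo.sub hU hT (SplitTo.add hU hT ((hG j c).dx hU hT (by simp) i)
      (((hG i c).dx hU hT (by simp) j).mono (by intro x; simp; tauto)))
      (((hG i j).dx hU hT (by simp) c).mono (by intro x; simp; tauto))
  exact (SplitTo.mul hU hT (SplitTo.inv hU hT hdet hG l c) h (c := c) (by simp)
    (by simp)).mono (by intro x; simp; tauto)

theorem SplitTo.curv (hU : IsOpen U) (hT : 0 < T)
    (hdet : ∀ y ∈ U, ∀ t ∈ Icc 0 T, (G y t).det ≠ 0)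
    (hG : ∀ i j, SplitTo U T b τ k [i, j] (fun y t => G y t i j)) (i j l m : ι) :
    SplitTo U T b τ k [i, j, l, m] (fun y t => curv b G i j l m y t) := by
  have hΓ := SplitTo.christoffel hU hT hdet hG
  unfold RicciProduct.curv
  refine SplitTo.add hU hT (SplitTo.sub hU hT
    (((hΓ m j l).dx hU hT (by simp) i).mono (by intro x; simp; tauto))
    (((hΓ m i l).dx hU hT (by simp) j).mono (by intro x; simp; tauto)))
    (SplitTo.sum hU hT fun p _ => SplitTo.sub hU hT ?_ ?_)
  · exact ((hΓ m i p).mul hU hT (hΓ p j l) (c := p) (by simp) (by simp)).mono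
      (by intro x; simp; tauto)
  · exact ((hΓ m j p).mul hU hT (hΓ p i l) (c := p) (by simp) (by simp)).mono
      (by intro x; simp; tauto)

theorem SplitTo.curvLow (hU : IsOpen U) (hT : 0 < T)
    (hdet : ∀ y ∈ U, ∀ t ∈ Icc 0 T, (G y t).det ≠ 0)
    (hG : ∀ i j, SplitTo U T b τ k [i, j] (fun y t => G y t i j)) (i j l m : ι) :
    SplitTo U T b τ k [i, j, l, m] (fun y t => curvLow b G i j l m y t) := by
  unfold RicciProduct.curvLow
  refine SplitTo.sum hU hT fun p _ => ?_
  exact ((hG m p).mul hU hT (SplitTo.curv hU hT hdet hG i j l p) (c := p) (by simp)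
    (by simp)).mono (by intro x; simp; tauto)

theorem SplitTo.ricci (hU : IsOpen U) (hT : 0 < T)
    (hdet : ∀ y ∈ U, ∀ t ∈ Icc 0 T, (G y t).det ≠ 0)
    (hG : ∀ i j, SplitTo U T b τ k [i, j] (fun y t => G y t i j)) (i j : ι) :
    SplitTo U T b τ k [i, j] (fun y t => ricci b G y t i j) := by
  simp only [RicciProduct.ricci, Matrix.of_apply]
  exact SplitTo.sum hU hT fun p _ => (SplitTo.curv hU hT hdet hG p i j p).mono
    (by intro x; simp; tauto)

theorem SplitTo.ricciEnd (hU : IsOpen U) (hT : 0 < T)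
    (hdet : ∀ y ∈ U, ∀ t ∈ Icc 0 T, (G y t).det ≠ 0)
    (hG : ∀ i j, SplitTo U T b τ k [i, j] (fun y t => G y t i j)) (i j : ι) :
    SplitTo U T b τ k [i, j] (fun y t => ricciEnd b G y t i j) := by
  simp only [RicciProduct.ricciEnd, Matrix.mul_apply]
  exact SplitTo.sum hU hT fun p _ => ((SplitTo.inv hU hT hdet hG i p).mul hU hT
    (SplitTo.ricci hU hT hdet hG p j) (c := p) (by simp) (by simp)).mono
    (by intro x; simp; tauto)

/-- A Ricci flow which splits at time zero splits to all orders in time at time zero. -/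
theorem SplitTo.of_flow (hU : IsOpen U) (hT : 0 < T)
    (hdet : ∀ y ∈ U, ∀ t ∈ Icc 0 T, (G y t).det ≠ 0)
    (hflow : ∀ i j, EqOnST U T (dt T fun y t => G y t i j) (fun y t => -2 * RicciProduct.ricci b G y t i j))
    (hG : ∀ i j, SplitTo U T b τ 0 [i, j] (fun y t => G y t i j)) (k : ℕ) (i j : ι) :
    SplitTo U T b τ k [i, j] (fun y t => G y t i j) := by
  induction k generalizing i j with
  | zero => exact hG i j
  | succ k ih =>
    -- The order is gained here: the Ricci tensor splits to the same order `k` as the metric, and by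
    -- the flow it is, up to a constant, the time derivative of the metric.
    have hR := (SplitTo.ricci hU hT hdet ih i j).const_mul hU hT (-2)
    refine ⟨(hG i j).smooth, fun h => ⟨(hG i j).vanish h, ?_⟩, fun a h => ⟨(hG i j).deriv a h, ?_⟩⟩
    · exact (hR.vanish h).congr hT.le (hflow i j)
    · exact (hR.deriv a h).congr hT.le
        (((hG i j).smooth.dt_dx_comm hU hT _).trans ((hflow i j).dx hU _))

end Curvature

/-! ### Vanishing to infinite order, and its invariance under `∇` and `D_t`. -/

section Flat

set_option linter.unusedSectionVars false

variable {E : Type*} [NormedAddCommGroup E] [NormedSpace ℝ E] {ι : Type*}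

/-- All time derivatives of `f` vanish at time zero. -/
def Flat (U : Set E) (T : ℝ) (f : E → ℝ → ℝ) : Prop := ∀ k, VanishTo U T k f

/-- All components of the tensor field `A` are flat at time zero. -/
def TensorFlat (U : Set E) (T : ℝ) {p q : ℕ} (A : TensorField E ι p q) : Prop :=
  ∀ J I, Flat U T (fun y t => A y t J I)

variable {U : Set E} {T : ℝ} {b : Module.Basis ι ℝ E} {τ : ι → Bool}

theorem Flat.congr (hT : 0 ≤ T) {f h : E → ℝ → ℝ} (hf : Flat U T f) (H : EqOnST U T h f) :
    Flat U T h := fun k => (hf k).congr hT H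

theorem Flat.smoothOn {f : E → ℝ → ℝ} (hf : Flat U T f) : SmoothOn U T f := (hf 0).1

theorem Flat.add (hT : 0 ≤ T) {f h : E → ℝ → ℝ} (hf : Flat U T f) (hh : Flat U T h) :
    Flat U T (fun y t => f y t + h y t) := fun k => (hf k).add hT (hh k)

theorem Flat.sub (hU : IsOpen U) (hT : 0 < T) {f h : E → ℝ → ℝ} (hf : Flat U T f)
    (hh : Flat U T h) : Flat U T (fun y t => f y t - h y t) := fun k => (hf k).sub hU hT (hh k)

theorem Flat.sum (hT : 0 ≤ T) {α : Type*} {s : Finset α} {f : α → E → ℝ → ℝ}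
    (hf : ∀ a ∈ s, Flat U T (f a)) : Flat U T (fun y t => ∑ a ∈ s, f a y t) :=
  fun k => VanishTo.sum hT fun a ha => hf a ha k

theorem Flat.mul_right (hU : IsOpen U) (hT : 0 < T) {f h : E → ℝ → ℝ} (hf : Flat U T f)
    (hh : SmoothOn U T h) : Flat U T (fun y t => f y t * h y t) :=
  fun k => (hf k).mul_right hU hT hh

theorem Flat.mul_left (hU : IsOpen U) (hT : 0 < T) {f h : E → ℝ → ℝ} (hh : SmoothOn U T h)
    (hf : Flat U T f) : Flat U T (fun y t => h y t * f y t) :=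
  fun k => (hf k).mul_left hU hT hh

theorem Flat.dx (hU : IsOpen U) (hT : 0 < T) {f : E → ℝ → ℝ} (hf : Flat U T f) (v : E) :
    Flat U T (dx v f) := fun k => (hf k).dx hU hT v

theorem Flat.dt {f : E → ℝ → ℝ} (hf : Flat U T f) : Flat U T (dt T f) := fun k => (hf (k + 1)).2

theorem flat_zero : Flat U T (fun _ _ => 0) := vanishTo_zero_fun

variable [Fintype ι] [DecidableEq ι] {G : E → ℝ → Matrix ι ι ℝ}

theorem TensorFlat.nabla (hU : IsOpen U) (hT : 0 < T)
    (hΓ : ∀ l i j, SmoothOn U T (fun y t => christoffel b G l i j y t)) {p q : ℕ}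
    {A : TensorField E ι p q} (hA : TensorFlat U T A) : TensorFlat U T (nabla b G A) := by
  intro J I
  refine Flat.sub hU hT (Flat.add hT.le ((hA J _).dx hU hT _) ?_) ?_
  · exact Flat.sum hT.le fun r _ => Flat.sum hT.le fun c _ => (hA _ _).mul_left hU hT (hΓ _ _ _)
  · exact Flat.sum hT.le fun r _ => Flat.sum hT.le fun c _ => (hA _ _).mul_left hU hT (hΓ _ _ _)

theorem TensorFlat.nablaIter (hU : IsOpen U) (hT : 0 < T)
    (hΓ : ∀ l i j, SmoothOn U T (fun y t => christoffel b G l i j y t)) {p q : ℕ}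
    {A : TensorField E ι p q} (hA : TensorFlat U T A) (l : ℕ) :
    TensorFlat U T (nablaIter b G A l) := by
  induction l with
  | zero => exact hA
  | succ l ih => exact ih.nabla hU hT hΓ

/-- Needed for `𝒫`, which is not flat itself: it agrees to infinite order with a constant tensor
that is nonzero in general, and only its covariant derivative is flat. -/
theorem TensorFlat.nablaIter_succ (hU : IsOpen U) (hT : 0 < T)
    (hΓ : ∀ l i j, SmoothOn U T (fun y t => christoffel b G l i j y t)) {p q : ℕ}
    {A : TensorField E ι p q} (hA : TensorFlat U T (RicciProduct.nabla b G A)) (l : ℕ) :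
    TensorFlat U T (RicciProduct.nablaIter b G A (l + 1)) := by
  induction l with
  | zero => exact hA
  | succ l ih => exact ih.nabla hU hT hΓ

/-- `D_t` is the time derivative plus an algebraic operator with smooth coefficients. -/
theorem TensorFlat.Dt (hU : IsOpen U) (hT : 0 < T)
    (hR : ∀ i j, SmoothOn U T (fun y t => ricci b G y t i j))
    (hI : ∀ i j, SmoothOn U T (fun y t => (G y t)⁻¹ i j)) {p q : ℕ}
    {A : TensorField E ι p q} (hA : TensorFlat U T A) : TensorFlat U T (Dt b G T A) := by
  intro J I
  refine Flat.add hT.le (hA J I).dt (Flat.sum hT.le fun a _ => Flat.sum hT.le fun d _ =>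
    Flat.sum hT.le fun c _ => Flat.mul_left hU hT ((hR a d).mul (hI d c)) ?_)
  have h1 : ∀ (P : Prop) [Decidable P] (f : E → ℝ → ℝ), Flat U T f →
      Flat U T (fun y t => if P then f y t else 0) := by
    intro P _ f hf
    by_cases h : P
    · simpa [h] using hf
    · simpa [h] using flat_zero
  exact Flat.sub hU hT (Flat.sum hT.le fun s _ => h1 _ _ (hA _ _))
    (Flat.sum hT.le fun r _ => h1 _ _ (hA _ _))

theorem TensorFlat.Dt_iterate (hU : IsOpen U) (hT : 0 < T)
    (hR : ∀ i j, SmoothOn U T (fun y t => ricci b G y t i j))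
    (hI : ∀ i j, SmoothOn U T (fun y t => (G y t)⁻¹ i j)) {p q : ℕ}
    {A : TensorField E ι p q} (hA : TensorFlat U T A) (k : ℕ) :
    TensorFlat U T ((RicciProduct.Dt b G T)^[k] A) := by
  induction k with
  | zero => exact hA
  | succ k ih =>
    rw [Function.iterate_succ_apply']
    exact ih.Dt hU hT hR hI

theorem TensorFlat.apply_zero {p q : ℕ} {A : TensorField E ι p q} (hA : TensorFlat U T A) {y : E}
    (hy : y ∈ U) : A y 0 = 0 := by
  funext J I
  exact (hA J I 0).2 y hy

/-- The constant projection onto the factor `s`. -/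
def factorProj (τ : ι → Bool) (s : Bool) : Matrix ι ι ℝ :=
  Matrix.diagonal fun i => if τ i = s then 1 else 0

/-- A solution of the projection equation, equal to a factor projection at time zero, is equal to
it to all orders. -/
theorem Flat.of_projectionODE (hU : IsOpen U) (hT : 0 < T)
    (hdet : ∀ y ∈ U, ∀ t ∈ Icc 0 T, (G y t).det ≠ 0)
    (hG : ∀ k i j, SplitTo U T b τ k [i, j] (fun y t => G y t i j)) (s : Bool)
    {P : E → ℝ → Matrix ι ι ℝ} (hP : ∀ i j, SmoothOn U T (fun y t => P y t i j))
    (hP0 : ∀ y ∈ U, P y 0 = factorProj τ s)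
    (hode : ∀ i j, EqOnST U T (RicciProduct.dt T fun y t => P y t i j) (fun y t =>
      (ricciEnd b G y t * P y t - P y t * ricciEnd b G y t) i j)) (i j : ι) :
    Flat U T (fun y t => P y t i j - factorProj τ s i j) := by
  intro k
  have hR := fun k => SplitTo.ricciEnd hU hT hdet (hG k)
  have h0 : ∀ i j, VanishTo U T 0 (fun y t => P y t i j - factorProj τ s i j) := fun i j =>
    ⟨(hP i j).sub (SmoothOn.const _), fun y hy => by simp [hP0 y hy]⟩
  induction k generalizing i j with
  | zero => exact h0 i j
  | succ k ih =>
    refine ⟨h0 i j, ?_⟩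
    have h1 : EqOnST U T (RicciProduct.dt T (fun y t => P y t i j - factorProj τ s i j))
        (fun y t => (∑ c, ricciEnd b G y t i c * (P y t c j - factorProj τ s c j)
          - ∑ c, (P y t i c - factorProj τ s i c) * ricciEnd b G y t c j) +
          ricciEnd b G y t i j *
            ((if τ j = s then 1 else 0) - (if τ i = s then 1 else 0))) := by
      have h2 : EqOnST U T (RicciProduct.dt T (fun y t => P y t i j - factorProj τ s i j))
          (RicciProduct.dt T (fun y t => P y t i j)) := by
        intro y hy t ht
        simp only [RicciProduct.dt, derivWithin_sub_const]
      refine (h2.trans (hode i j)).trans fun y hy t ht => ?_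
      -- The first commutator is linear in the error, which vanishes to order `k` by induction. The
      -- second one, with the constant projection, has entries `ricciEnd i j` times a coefficient
      -- that is zero when `i` and `j` belong to the same factor; otherwise `ricciEnd i j` vanishes
      -- to order `k`.
      have h3 : ricciEnd b G y t * P y t - P y t * ricciEnd b G y t =
          (ricciEnd b G y t * (P y t - factorProj τ s)
            - (P y t - factorProj τ s) * ricciEnd b G y t) +
          (ricciEnd b G y t * factorProj τ s - factorProj τ s * ricciEnd b G y t) := by
        rw [mul_sub, sub_mul]; abel
      beta_reduce
      rw [h3, Matrix.add_apply, Matrix.sub_apply, Matrix.sub_apply, Matrix.mul_apply,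
        Matrix.mul_apply, factorProj, Matrix.mul_diagonal, Matrix.diagonal_mul]
      simp only [Matrix.sub_apply]
      ring
    refine VanishTo.congr hT.le (VanishTo.add hT.le (VanishTo.sub hU hT
      (VanishTo.sum hT.le fun c _ => (ih c j).mul_left hU hT (hR k i c).smooth)
      (VanishTo.sum hT.le fun c _ => (ih i c).mul_right hU hT (hR k c j).smooth)) ?_) h1
    by_cases h : τ i = τ j
    · simpa [h] using vanishTo_zero_fun k
    · exact ((hR k i j).vanish fun h' => h (h' i (by simp) j (by simp))).mul_right hU hT
        (SmoothOn.const _)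

end Flat

/-! ### The tensors `ℛ` and `∇𝒫` are flat. -/

section MixedForms

set_option linter.unusedSectionVars false

variable {E : Type*} [NormedAddCommGroup E] [NormedSpace ℝ E] {ι : Type*} [Fintype ι]
  [DecidableEq ι] {U : Set E} {T : ℝ} {b : Module.Basis ι ℝ E} {τ : ι → Bool}
  {G Ph Pc : E → ℝ → Matrix ι ι ℝ}

theorem SmoothOn.of_sub_const {f : E → ℝ → ℝ} {c : ℝ} (hf : SmoothOn U T (fun y t => f y t - c)) :
    SmoothOn U T f :=
  (hf.add (SmoothOn.const c)).congr fun _ _ _ _ => (sub_add_cancel _ _).symm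

/-- `1` if the two indices belong to different factors, `0` otherwise. -/
def mixSign (τ : ι → Bool) (i j : ι) : ℝ := if τ i = τ j then 0 else 1

theorem mixOp_factorProj (η : Matrix ι ι ℝ) (i j : ι) :
    mixOp (factorProj τ true) (factorProj τ false) η i j = mixSign τ i j * η i j := by
  have h : ∀ (s s' : Bool), ∑ k, ∑ l, factorProj τ s k i * factorProj τ s' l j * η k l =
      (if τ i = s then 1 else 0) * (if τ j = s' then 1 else 0) * η i j := by
    intro s s'
    rw [Finset.sum_eq_single i, Finset.sum_eq_single j]
    · simp [factorProj]
    · intro l _ hl; simp [factorProj, Matrix.diagonal_apply_ne _ hl]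
    · simp
    · intro k _ hk; simp [factorProj, Matrix.diagonal_apply_ne _ hk]
    · simp
  simp only [mixOp, Matrix.of_apply, Finset.sum_add_distrib, h]
  unfold mixSign
  cases τ i <;> cases τ j <;> simp

/-- Telescope each product as `P Q - P₀ Q₀ = (P - P₀) Q + P₀ (Q - Q₀)`, with `P₀`, `Q₀` the constant
projections. -/
theorem Flat.mixOp (hU : IsOpen U) (hT : 0 < T)
    (hPh : ∀ i j, Flat U T (fun y t => Ph y t i j - factorProj τ true i j))
    (hPc : ∀ i j, Flat U T (fun y t => Pc y t i j - factorProj τ false i j))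
    (η : Matrix ι ι ℝ) (i j : ι) :
    Flat U T (fun y t => mixOp (Ph y t) (Pc y t) η i j - mixSign τ i j * η i j) := by
  have hs : ∀ {P : E → ℝ → Matrix ι ι ℝ} {s : Bool},
      (∀ i j, Flat U T (fun y t => P y t i j - factorProj τ s i j)) →
      ∀ i j, SmoothOn U T (fun y t => P y t i j) := fun h i j =>
    (h i j).smoothOn.of_sub_const
  have hp : ∀ {P Q : E → ℝ → Matrix ι ι ℝ} {s s' : Bool},
      (∀ i j, Flat U T (fun y t => P y t i j - factorProj τ s i j)) →
      (∀ i j, Flat U T (fun y t => Q y t i j - factorProj τ s' i j)) → ∀ k l,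
      Flat U T (fun y t => P y t k i * Q y t l j * η k l
        - factorProj τ s k i * factorProj τ s' l j * η k l) := by
    intro P Q s s' hP hQ k l
    refine (((hP k i).mul_right hU hT ((hs hQ l j).mul (SmoothOn.const (η k l)))).add hT.le
      ((hQ l j).mul_left hU hT (SmoothOn.const (factorProj τ s k i * η k l)))).congr hT.le ?_
    intro y _ t _
    ring
  refine (Flat.sum hT.le fun k (_ : k ∈ Finset.univ) => Flat.sum hT.le
    fun l (_ : l ∈ Finset.univ) => (hp hPh hPc k l).add hT.le (hp hPc hPh k l)).congr hT.le ?_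
  intro y _ t _
  rw [← mixOp_factorProj]
  simp only [RicciProduct.mixOp, Matrix.of_apply, ← Finset.sum_sub_distrib]
  refine Finset.sum_congr rfl fun k _ => Finset.sum_congr rfl fun l _ => ?_
  ring

/-- Consider a term `g^{kp} g^{lq} R_{ijpq} (𝒫η)_{lk}`. The last factor is flat unless `k` and `l`
lie in different factors, and the inverse metrics are flat unless `p` and `q` lie in the factors of
`k` and `l`. In the remaining case `p, q` are mixed and the curvature component is flat. -/
theorem TensorFlat.calR (hU : IsOpen U) (hT : 0 < T)
    (hdet : ∀ y ∈ U, ∀ t ∈ Icc 0 T, (G y t).det ≠ 0)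
    (hG : ∀ k i j, SplitTo U T b τ k [i, j] (fun y t => G y t i j))
    (hPh : ∀ i j, Flat U T (fun y t => Ph y t i j - factorProj τ true i j))
    (hPc : ∀ i j, Flat U T (fun y t => Pc y t i j - factorProj τ false i j)) :
    TensorFlat U T (calR b G Ph Pc) := by
  intro J I
  have hI := fun k => SplitTo.inv hU hT hdet (hG k)
  have hR := fun k => SplitTo.curvLow hU hT hdet (hG k)
  have hI' : ∀ i j, τ i ≠ τ j → Flat U T (fun y t => (G y t)⁻¹ i j) := fun i j h k =>
    (hI k i j).vanish fun h' => h (h' i (by simp) j (by simp))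
  have hM := Flat.mixOp hU hT hPh hPc (wedge (J 0) (J 1))
  have hMs : ∀ i j, SmoothOn U T (fun y t => RicciProduct.mixOp (Ph y t) (Pc y t)
      (wedge (J 0) (J 1)) i j) := fun i j =>
    (hM i j).smoothOn.of_sub_const
  refine Flat.mul_left hU hT (SmoothOn.const _) (Flat.sum hT.le fun k _ => Flat.sum hT.le
    fun l _ => Flat.sum hT.le fun p _ => Flat.sum hT.le fun q _ => ?_)
  have sI := fun i j => (hI 0 i j).smooth
  have sR := fun i j p q => (hR 0 i j p q).smooth
  by_cases h1 : τ k = τ p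
  · by_cases h2 : τ l = τ q
    · by_cases h3 : τ k = τ l
      · refine Flat.mul_left hU hT (((sI k p).mul (sI l q)).mul (sR _ _ p q)) ?_
        simpa [mixSign, h3] using hM l k
      · refine Flat.mul_right hU hT (Flat.mul_left hU hT ((sI k p).mul (sI l q)) ?_) (hMs l k)
        refine fun n => (hR n _ _ p q).vanish fun h => h3 ?_
        rw [h1, h2]
        exact h p (by simp) q (by simp)
    · exact Flat.mul_right hU hT (Flat.mul_right hU hT (Flat.mul_left hU hT (sI k p) (hI' l q h2))
        (sR _ _ p q)) (hMs l k)
  · exact Flat.mul_right hU hT (Flat.mul_right hU hT (Flat.mul_right hU hT (hI' k p h1) (sI l q))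
        (sR _ _ p q)) (hMs l k)

theorem wedge_apply (k l i j : ι) : (wedge k l : Matrix ι ι ℝ) i j =
    (if i = k then 1 else 0) * (if j = l then 1 else 0)
      - (if i = l then 1 else 0) * (if j = k then 1 else 0) := by
  simp only [wedge, Matrix.of_apply, ite_and, mul_ite, mul_one, mul_zero]
  split_ifs <;> simp

theorem mixSign_comm (i j : ι) : mixSign τ i j = mixSign τ j i := by
  simp [mixSign, eq_comm]

/-- The contraction of a connection matrix with the constant mixed projection. -/
theorem sum_christoffel_mixSign_wedge (Γ : ι → ι → ℝ) (k l i j : ι) :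
    (∑ c, Γ k c * (1 / 2 * (mixSign τ i j * (wedge c l : Matrix ι ι ℝ) i j))
      + ∑ c, Γ l c * (1 / 2 * (mixSign τ i j * (wedge k c : Matrix ι ι ℝ) i j)))
      - (∑ c, Γ c i * (1 / 2 * (mixSign τ c j * (wedge k l : Matrix ι ι ℝ) c j))
      + ∑ c, Γ c j * (1 / 2 * (mixSign τ i c * (wedge k l : Matrix ι ι ℝ) i c))) =
    1 / 2 * ((mixSign τ i j - mixSign τ k l) * (if j = l then 1 else 0) * Γ k i
      - (mixSign τ i j - mixSign τ k l) * (if i = l then 1 else 0) * Γ k j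
      + (mixSign τ i j - mixSign τ k l) * (if i = k then 1 else 0) * Γ l j
      - (mixSign τ i j - mixSign τ k l) * (if j = k then 1 else 0) * Γ l i) := by
  have h1 : ∀ (F : ι → ℝ) (x : ι), ∑ c, F c * (if c = x then (1 : ℝ) else 0) = F x := by
    intro F x; simp
  have h2 : ∀ (F : ι → ℝ) (x : ι), ∑ c, F c * (if x = c then (1 : ℝ) else 0) = F x := by
    intro F x; simp
  have e1 : ∑ c, Γ k c * (1 / 2 * (mixSign τ i j * (wedge c l : Matrix ι ι ℝ) i j)) =
      1 / 2 * mixSign τ i j * (if j = l then 1 else 0) * Γ k i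
        - 1 / 2 * mixSign τ i j * (if i = l then 1 else 0) * Γ k j := by
    rw [← h2 (Γ k) i, ← h2 (Γ k) j, Finset.mul_sum, Finset.mul_sum, ← Finset.sum_sub_distrib]
    refine Finset.sum_congr rfl fun c _ => ?_
    rw [wedge_apply]; ring
  have e2 : ∑ c, Γ l c * (1 / 2 * (mixSign τ i j * (wedge k c : Matrix ι ι ℝ) i j)) =
      1 / 2 * mixSign τ i j * (if i = k then 1 else 0) * Γ l j
        - 1 / 2 * mixSign τ i j * (if j = k then 1 else 0) * Γ l i := by
    rw [← h2 (Γ l) i, ← h2 (Γ l) j, Finset.mul_sum, Finset.mul_sum, ← Finset.sum_sub_distrib]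
    refine Finset.sum_congr rfl fun c _ => ?_
    rw [wedge_apply]; ring
  have e3 : ∑ c, Γ c i * (1 / 2 * (mixSign τ c j * (wedge k l : Matrix ι ι ℝ) c j)) =
      1 / 2 * (if j = l then 1 else 0) * (Γ k i * mixSign τ k j)
        - 1 / 2 * (if j = k then 1 else 0) * (Γ l i * mixSign τ l j) := by
    rw [← h1 (fun c => Γ c i * mixSign τ c j) k, ← h1 (fun c => Γ c i * mixSign τ c j) l,
      Finset.mul_sum, Finset.mul_sum, ← Finset.sum_sub_distrib]
    refine Finset.sum_congr rfl fun c _ => ?_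
    rw [wedge_apply]; ring
  have e4 : ∑ c, Γ c j * (1 / 2 * (mixSign τ i c * (wedge k l : Matrix ι ι ℝ) i c)) =
      1 / 2 * (if i = k then 1 else 0) * (Γ l j * mixSign τ i l)
        - 1 / 2 * (if i = l then 1 else 0) * (Γ k j * mixSign τ i k) := by
    rw [← h1 (fun c => Γ c j * mixSign τ i c) k, ← h1 (fun c => Γ c j * mixSign τ i c) l,
      Finset.mul_sum, Finset.mul_sum, ← Finset.sum_sub_distrib]
    refine Finset.sum_congr rfl fun c _ => ?_
    rw [wedge_apply]; ring
  -- The sums leave `mixSign` at one lower and one upper index; the accompanying Kronecker delta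
  -- allows the lower index to be replaced by the upper one, which produces `mixSign τ k l`.
  have d : ∀ (x z : ι) (F : ι → ℝ), (if x = z then (1 : ℝ) else 0) * F x =
      (if x = z then (1 : ℝ) else 0) * F z := by
    intro x z F
    split_ifs with h
    · rw [h]
    · simp
  rw [e1, e2, e3, e4]
  have d1 := d j l (mixSign τ k)
  have d2 := d j k (mixSign τ l)
  have d3 := d i k (fun x => mixSign τ x l)
  have d4 := d i l (fun x => mixSign τ x k)
  rw [mixSign_comm l k] at d2 d4
  linear_combination (-1 / 2 * Γ k i) * d1 + (1 / 2 * Γ l i) * d2 - (1 / 2 * Γ l j) * d3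
    + (1 / 2 * Γ k j) * d4

/-- Subtract the constant mixed projection `C`: the difference is flat, hence so is its covariant
derivative. What remains is the action of the Christoffel symbols on `C`. An entry `Γ^l_{ai}` with
`l, i` in the same factor commutes with the projection and drops out, and the other entries are
flat. -/
theorem TensorFlat.nabla_calP (hU : IsOpen U) (hT : 0 < T)
    (hdet : ∀ y ∈ U, ∀ t ∈ Icc 0 T, (G y t).det ≠ 0)
    (hG : ∀ k i j, SplitTo U T b τ k [i, j] (fun y t => G y t i j))
    (hPh : ∀ i j, Flat U T (fun y t => Ph y t i j - factorProj τ true i j))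
    (hPc : ∀ i j, Flat U T (fun y t => Pc y t i j - factorProj τ false i j)) :
    TensorFlat U T (RicciProduct.nabla b G (calP Ph Pc)) := by
  have hΓ := fun k => SplitTo.christoffel hU hT hdet (hG k)
  have sΓ := fun l i j => (hΓ 0 l i j).smooth
  have fΓ : ∀ l a i, τ l ≠ τ i → Flat U T (fun y t => christoffel b G l a i y t) :=
    fun l a i h k => (hΓ k l a i).vanish fun h' => h (h' l (by simp) i (by simp))
  set C : (Fin 2 → ι) → (Fin 2 → ι) → ℝ := fun J I =>
    1 / 2 * (mixSign τ (I 0) (I 1) * (wedge (J 0) (J 1) : Matrix ι ι ℝ) (I 0) (I 1)) with hC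
  have hD : TensorFlat U T (fun y t J I => calP Ph Pc y t J I - C J I) := fun J I =>
    ((Flat.mixOp hU hT hPh hPc (wedge (J 0) (J 1)) (I 0) (I 1)).mul_left hU hT
      (SmoothOn.const (1 / 2))).congr hT.le fun y _ t _ => by
        simp only [calP, endTensor, hC]; ring
  intro J I
  have key : Flat U T (fun y t => 1 / 2 *
      ((mixSign τ (I 1) (I 2) - mixSign τ (J 0) (J 1)) * (if I 2 = J 1 then 1 else 0)
          * christoffel b G (J 0) (I 0) (I 1) y t
        - (mixSign τ (I 1) (I 2) - mixSign τ (J 0) (J 1)) * (if I 1 = J 1 then 1 else 0)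
          * christoffel b G (J 0) (I 0) (I 2) y t
        + (mixSign τ (I 1) (I 2) - mixSign τ (J 0) (J 1)) * (if I 1 = J 0 then 1 else 0)
          * christoffel b G (J 1) (I 0) (I 2) y t
        - (mixSign τ (I 1) (I 2) - mixSign τ (J 0) (J 1)) * (if I 2 = J 0 then 1 else 0)
          * christoffel b G (J 1) (I 0) (I 1) y t)) := by
    -- In each of the four terms the delta identifies one lower index with one upper index. If the
    -- other two, which are those of `Γ`, lie in the same factor, the two values of `mixSign` agree
    -- and the coefficient is zero.
    have h0 : ∀ (c : ℝ) (l a i : ι), (τ l = τ i → c = 0) →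
        Flat U T (fun y t => c * christoffel b G l a i y t) := by
      intro c l a i h
      by_cases h' : τ l = τ i
      · simpa [h h'] using flat_zero
      · exact (fΓ l a i h').mul_left hU hT (SmoothOn.const c)
    refine Flat.mul_left hU hT (SmoothOn.const _) (Flat.sub hU hT (Flat.add hT.le
      (Flat.sub hU hT (h0 _ _ _ _ ?_) (h0 _ _ _ _ ?_)) (h0 _ _ _ _ ?_)) (h0 _ _ _ _ ?_)) <;>
    · intro h
      split_ifs with h'
      · simp [mixSign, h, h', eq_comm]
      · simp
  refine (((hD.nabla (b := b) (G := G) hU hT sΓ) J I).add hT.le key).congr hT.le ?_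
  intro y hy t ht
  beta_reduce
  rw [← sum_christoffel_mixSign_wedge (fun l i => christoffel b G l (I 0) i y t)]
  have hpd : pd b (I 0) (fun z => calP Ph Pc z t J (Fin.tail I) - C J (Fin.tail I)) y =
      pd b (I 0) (fun z => calP Ph Pc z t J (Fin.tail I)) y := by
    simp only [pd, fderiv_sub_const]
  simp only [RicciProduct.nabla, hpd, mul_sub, Finset.sum_sub_distrib]
  have t1 : ∑ r, ∑ c, christoffel b G (J r) (I 0) c y t * C (Function.update J r c) (Fin.tail I) =
      ∑ c, christoffel b G (J 0) (I 0) c y t * (1 / 2 * (mixSign τ (I 1) (I 2) *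
        (wedge c (J 1) : Matrix ι ι ℝ) (I 1) (I 2))) +
      ∑ c, christoffel b G (J 1) (I 0) c y t * (1 / 2 * (mixSign τ (I 1) (I 2) *
        (wedge (J 0) c : Matrix ι ι ℝ) (I 1) (I 2))) := by
    rw [Fin.sum_univ_two]
    simp [hC, Fin.tail]
  have t2 : ∑ s, ∑ c, christoffel b G c (I 0) (Fin.tail I s) y t *
        C J (Function.update (Fin.tail I) s c) =
      ∑ c, christoffel b G c (I 0) (I 1) y t * (1 / 2 * (mixSign τ c (I 2) *
        (wedge (J 0) (J 1) : Matrix ι ι ℝ) c (I 2))) +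
      ∑ c, christoffel b G c (I 0) (I 2) y t * (1 / 2 * (mixSign τ (I 1) c *
        (wedge (J 0) (J 1) : Matrix ι ι ℝ) (I 1) c)) := by
    rw [Fin.sum_univ_two]
    simp [hC, Fin.tail]
  rw [t1, t2]
  ring

end MixedForms

/-! ### Linear differential equations on a closed interval: existence. -/

section LinearODE

set_option linter.unusedSectionVars false

/-- The bound is linear in the initial value and the inhomogeneity together. This turns Grönwall's
inequality into an estimate proportional to the perturbation, as differentiability in parameters
requires. -/
theorem gronwallBound_mul_right (K ε x : ℝ) :
    gronwallBound ε K ε x = gronwallBound 1 K 1 x * ε := by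
  unfold gronwallBound
  split_ifs <;> ring

theorem hasDerivWithinAt_Ici_of_Icc {V : Type*} [NormedAddCommGroup V] [NormedSpace ℝ V] {T : ℝ}
    {r : ℝ → V} {r' : V} {t : ℝ} (ht : t ∈ Ico 0 T)
    (h : HasDerivWithinAt r r' (Icc 0 T) t) : HasDerivWithinAt r r' (Ici t) t :=
  h.mono_of_mem_nhdsWithin (mem_nhdsWithin.2 ⟨Iio T, isOpen_Iio, ht.2,
    fun _ hx => ⟨ht.1.trans hx.2, le_of_lt hx.1⟩⟩)

/-- Grönwall's inequality with a bound linear in the size of the perturbation. -/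
theorem norm_le_of_norm_deriv_le {V : Type*} [NormedAddCommGroup V] [NormedSpace ℝ V] {T K ε : ℝ}
    (hK : 0 ≤ K) (hε : 0 ≤ ε) {r r' : ℝ → V}
    (hr : ∀ t ∈ Icc 0 T, HasDerivWithinAt r (r' t) (Icc 0 T) t) (h0 : ‖r 0‖ ≤ ε)
    (hbd : ∀ t ∈ Icc 0 T, ‖r' t‖ ≤ K * ‖r t‖ + ε) :
    ∀ t ∈ Icc 0 T, ‖r t‖ ≤ gronwallBound 1 K 1 T * ε := by
  intro t ht
  have h1 := norm_le_gronwallBound_of_norm_deriv_right_le (f := r) (f' := r') (δ := ε) (K := K)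
    (ε := ε) (fun s hs => (hr s hs).continuousWithinAt)
    (fun s hs => hasDerivWithinAt_Ici_of_Icc hs (hr s (Ico_subset_Icc_self hs))) h0
    (fun s hs => hbd s (Ico_subset_Icc_self hs)) t ht
  refine h1.trans ((gronwallBound_mono hε hε hK ?_).trans (gronwallBound_mul_right _ _ _).le)
  simpa using ht.2

/-- A linear differential equation with continuous coefficients has a solution on the whole
interval. -/
theorem exists_linearODE_solution {V : Type*} [NormedAddCommGroup V] [NormedSpace ℝ V]
    [FiniteDimensional ℝ V] {T : ℝ} (hT : 0 ≤ T) {A : ℝ → V →L[ℝ] V} {h : ℝ → V}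
    (hA : ContinuousOn A (Icc 0 T)) (hh : ContinuousOn h (Icc 0 T)) (x₀ : V) :
    ∃ x : ℝ → V, x 0 = x₀ ∧
      ∀ t ∈ Icc 0 T, HasDerivWithinAt x (A t (x t) + h t) (Icc 0 T) t := by
  have := FiniteDimensional.complete ℝ V
  obtain ⟨K, hK⟩ := isCompact_Icc.exists_bound_of_continuousOn hA
  obtain ⟨H, hH⟩ := isCompact_Icc.exists_bound_of_continuousOn hh
  have h00 : (0 : ℝ) ∈ Icc 0 T := ⟨le_rfl, hT⟩
  have hK0 : 0 ≤ K := (norm_nonneg _).trans (hK 0 h00)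
  have hH0 : 0 ≤ H := (norm_nonneg _).trans (hH 0 h00)
  set ε := max ‖x₀‖ H with hε
  have hε0 : 0 ≤ ε := le_max_of_le_right hH0
  -- `R` exceeds the a priori Grönwall bound. The equation is truncated by a cutoff equal to `1` on
  -- the ball of radius `R`; its right-hand side is then bounded and globally Lipschitz.
  set R := |gronwallBound 1 K 1 T * ε| + 1 with hR
  have hR0 : 0 < R := by positivity
  let χ : ContDiffBump (0 : V) := ⟨R, R + 1, hR0, by linarith⟩
  set ρ : V → V := fun v => χ v • v with hρ
  have hρsmooth : ContDiff ℝ 1 ρ := χ.contDiff.smul contDiff_id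
  have hρsupp : HasCompactSupport ρ := χ.hasCompactSupport.smul_right
  obtain ⟨C, hC⟩ := hρsupp.exists_bound_of_continuous hρsmooth.continuous
  have hC0 : 0 ≤ C := (norm_nonneg _).trans (hC 0)
  obtain ⟨Lρ, hLρ⟩ := hρsmooth.lipschitzWith_of_hasCompactSupport hρsupp (by simp)
  have hρle : ∀ v, ‖ρ v‖ ≤ ‖v‖ := by
    intro v
    rw [hρ, norm_smul, Real.norm_of_nonneg χ.nonneg]
    exact mul_le_of_le_one_left (norm_nonneg _) χ.le_one
  let L : NNReal := ⟨K * C + H, by positivity⟩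
  let K' : NNReal := ⟨K, hK0⟩
  let T' : NNReal := ⟨T, hT⟩
  -- A solution with speed at most `L` moves at most `L * T`, so Picard–Lindelöf on a ball of this
  -- radius covers the whole interval.
  let a : NNReal := L * T'
  have hPL : IsPicardLindelof (fun t v => A t (ρ v) + h t) (⟨0, h00⟩ : Icc 0 T) x₀ a 0 L
      (K' * Lρ) := by
    refine ⟨fun t ht => LipschitzWith.lipschitzOnWith ?_, fun v _ => ?_, fun t ht v _ => ?_, ?_⟩
    · refine LipschitzWith.of_dist_le_mul fun v w => ?_
      rw [dist_add_right, dist_eq_norm, ← map_sub]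
      refine ((A t).le_opNorm _).trans ?_
      rw [← dist_eq_norm, NNReal.coe_mul, mul_assoc (K' : ℝ)]
      exact mul_le_mul (hK t ht) (hLρ.dist_le_mul v w) dist_nonneg hK0
    · exact (hA.clm_apply continuousOn_const).add hh
    · refine (norm_add_le _ _).trans (add_le_add (((A t).le_opNorm _).trans ?_) (hH t ht))
      exact mul_le_mul (hK t ht) (hC v) (norm_nonneg _) hK0
    · change (L : ℝ) * max (T - 0) (0 - 0) ≤ ((L * T' : NNReal) : ℝ) - 0
      rw [NNReal.coe_mul, sub_zero, sub_zero, sub_zero, max_eq_left hT]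
      exact le_rfl
  obtain ⟨x, hx0, hx⟩ := hPL.exists_eq_forall_mem_Icc_hasDerivWithinAt₀
  refine ⟨x, hx0, fun t ht => ?_⟩
  -- Since `‖ρ v‖ ≤ ‖v‖`, the truncated equation obeys the same Grönwall bound; its solution stays
  -- where the cutoff is `1` and solves the original equation.
  have hb := norm_le_of_norm_deriv_le hK0 hε0 hx (by
    rw [show x 0 = x₀ from hx0]; exact le_max_left _ _) (fun s hs => by
      refine (norm_add_le _ _).trans (add_le_add (((A s).le_opNorm _).trans ?_)
        ((hH s hs).trans (le_max_right _ _)))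
      exact mul_le_mul (hK s hs) (hρle _) (norm_nonneg _) hK0) t ht
  have hρx : ρ (x t) = x t := by
    have : χ (x t) = 1 := χ.one_of_mem_closedBall (by
      rw [mem_closedBall_zero_iff]
      exact hb.trans ((le_abs_self _).trans (by change _ ≤ R; rw [hR]; linarith)))
    simp [hρ, this]
  have := hx t ht
  beta_reduce at this
  rwa [hρx] at this

/-! ### Linear differential equations: dependence on parameters. -/

section Parameters

variable {E : Type*} [NormedAddCommGroup E] [NormedSpace ℝ E] {F : Type*} [NormedAddCommGroup F]
  [NormedSpace ℝ F] {U : Set E} {T : ℝ}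

/-- The derivative of `A` in the space variables. -/
noncomputable def spaceFDeriv (U : Set E) (T : ℝ) (A : E → ℝ → F) (y : E) (t : ℝ) : E →L[ℝ] F :=
  (fderivWithin ℝ (fun p : E × ℝ => A p.1 p.2) (U ×ˢ Icc 0 T) (y, t)).comp
    (ContinuousLinearMap.inl ℝ E ℝ)

theorem contDiffOn_spaceFDeriv (hU : IsOpen U) (hT : 0 < T) {A : E → ℝ → F}
    (hA : ContDiffOn ℝ ∞ (fun p : E × ℝ => A p.1 p.2) (U ×ˢ Icc 0 T)) :
    ContDiffOn ℝ ∞ (fun p : E × ℝ => spaceFDeriv U T A p.1 p.2) (U ×ˢ Icc 0 T) :=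
  (hA.fderivWithin (uniqueDiffOn_ST hU hT) (m := ∞) (by simp)).clm_comp contDiffOn_const

theorem hasFDerivAt_spaceFDeriv (hU : IsOpen U) {A : E → ℝ → F}
    (hA : ContDiffOn ℝ ∞ (fun p : E × ℝ => A p.1 p.2) (U ×ˢ Icc 0 T)) {y : E} (hy : y ∈ U)
    {t : ℝ} (ht : t ∈ Icc 0 T) : HasFDerivAt (fun z => A z t) (spaceFDeriv U T A y t) y := by
  have h1 : HasFDerivWithinAt (fun z : E => (z, t)) (ContinuousLinearMap.inl ℝ E ℝ) U y := by
    simpa using (hasFDerivAt_prodMk_left (𝕜 := ℝ) y t).hasFDerivWithinAt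
  have h2 := ((hA (y, t) ⟨hy, ht⟩).differentiableWithinAt (by simp)).hasFDerivWithinAt
  have h3 : MapsTo (fun z : E => (z, t)) U (U ×ˢ Icc 0 T) := fun z hz => ⟨hz, ht⟩
  exact (h2.comp y h1 h3).hasFDerivAt (hU.mem_nhds hy)

/-- Taylor expansion to first order in the space variables, uniform in time. -/
theorem exists_uniform_linear_approx [FiniteDimensional ℝ E] (hU : IsOpen U) (hT : 0 < T)
    {A : E → ℝ → F}
    (hA : ContDiffOn ℝ ∞ (fun p : E × ℝ => A p.1 p.2) (U ×ˢ Icc 0 T)) {y₀ : E} (hy₀ : y₀ ∈ U)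
    {η : ℝ} (hη : 0 < η) : ∃ δ > 0, ∀ y, ‖y - y₀‖ < δ → ∀ t ∈ Icc 0 T,
      ‖A y t - A y₀ t - spaceFDeriv U T A y₀ t (y - y₀)‖ ≤ η * ‖y - y₀‖ := by
  have : ProperSpace E := FiniteDimensional.proper ℝ E
  obtain ⟨δ₀, hδ₀, hball⟩ := Metric.nhds_basis_closedBall.mem_iff.1 (hU.mem_nhds hy₀)
  have hcpt : IsCompact (Metric.closedBall y₀ δ₀ ×ˢ Icc (0 : ℝ) T) :=
    (isCompact_closedBall _ _).prod isCompact_Icc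
  have hsub : Metric.closedBall y₀ δ₀ ×ˢ Icc (0 : ℝ) T ⊆ U ×ˢ Icc 0 T :=
    prod_mono hball subset_rfl
  -- Uniform continuity of the spatial derivative on a compact ball times `[0, T]` gives one radius
  -- for all times; the mean value inequality does the rest.
  have huc := hcpt.uniformContinuousOn_of_continuous
    ((contDiffOn_spaceFDeriv hU hT hA).continuousOn.mono hsub)
  obtain ⟨δ₁, hδ₁, h1⟩ := Metric.uniformContinuousOn_iff.1 huc η hη
  refine ⟨min δ₀ δ₁, lt_min hδ₀ hδ₁, fun y hy t ht => ?_⟩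
  have hmem : ∀ z ∈ Metric.ball y₀ (min δ₀ δ₁), z ∈ Metric.closedBall y₀ δ₀ := fun z hz =>
    Metric.ball_subset_closedBall (Metric.ball_subset_ball (min_le_left _ _) hz)
  refine Convex.norm_image_sub_le_of_norm_hasFDerivWithin_le' (s := Metric.ball y₀ (min δ₀ δ₁))
    (f := fun z => A z t) (f' := fun z => spaceFDeriv U T A z t)
    (fun z hz => (hasFDerivAt_spaceFDeriv hU hA (hball (hmem z hz)) ht).hasFDerivWithinAt)
    (fun z hz => ?_) (convex_ball _ _) (Metric.mem_ball_self (lt_min hδ₀ hδ₁))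
    (by rwa [Metric.mem_ball, dist_eq_norm])
  have h2 := h1 (z, t) ⟨hmem z hz, ht⟩ (y₀, t) ⟨Metric.mem_closedBall_self hδ₀.le, ht⟩ (by
    rw [Prod.dist_eq, dist_self, max_eq_left dist_nonneg]
    exact (Metric.mem_ball.1 hz).trans_le (min_le_right _ _))
  rw [dist_eq_norm] at h2
  exact h2.le

variable {V : Type*} [NormedAddCommGroup V] [NormedSpace ℝ V] [FiniteDimensional ℝ E]
  {A : E → ℝ → V →L[ℝ] V} {u : E → ℝ → V}

/-- The coefficient of the linear equation for a solution together with its derivative in the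
parameters. -/
noncomputable def variationalOp (a : V →L[ℝ] V) (B : E →L[ℝ] V →L[ℝ] V) :
    (V × (E →L[ℝ] V)) →L[ℝ] (V × (E →L[ℝ] V)) :=
  (a.comp (ContinuousLinearMap.fst ℝ V (E →L[ℝ] V))).prod
    ((ContinuousLinearMap.compL ℝ E V V a).comp (ContinuousLinearMap.snd ℝ V (E →L[ℝ] V)) +
      B.flip.comp (ContinuousLinearMap.fst ℝ V (E →L[ℝ] V)))

theorem variationalOp_apply (a : V →L[ℝ] V) (B : E →L[ℝ] V →L[ℝ] V) (v : V) (W : E →L[ℝ] V) :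
    variationalOp a B (v, W) = (a v, a.comp W + B.flip v) := rfl

/-- The coefficient operators below depend linearly on their data, and on a finite-dimensional space
linearity alone gives smoothness. -/
theorem contDiff_of_finiteDimensional {X Y : Type*} [NormedAddCommGroup X]
    [NormedSpace ℝ X] [FiniteDimensional ℝ X] [NormedAddCommGroup Y] [NormedSpace ℝ Y]
    {f : X → Y} (hadd : ∀ x x', f (x + x') = f x + f x') (hsmul : ∀ (c : ℝ) x, f (c • x) = c • f x) :
    ContDiff ℝ ∞ f :=
  (LinearMap.toContinuousLinearMap
    ({ toFun := f, map_add' := hadd, map_smul' := hsmul } : X →ₗ[ℝ] Y)).contDiff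

set_option synthInstance.maxHeartbeats 200000 in
theorem contDiff_variationalOp [FiniteDimensional ℝ V] :
    ContDiff ℝ ∞ (fun q : (V →L[ℝ] V) × (E →L[ℝ] V →L[ℝ] V) => variationalOp q.1 q.2) := by
  refine contDiff_of_finiteDimensional (fun q q' => ?_) (fun c q => ?_)
  · refine ContinuousLinearMap.ext fun x => ?_
    obtain ⟨v, W⟩ := x
    rw [add_apply, variationalOp_apply, variationalOp_apply, variationalOp_apply]
    refine Prod.ext ?_ (ContinuousLinearMap.ext fun w => ?_)
    · simp
    · simp
      abel
  · refine ContinuousLinearMap.ext fun x => ?_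
    obtain ⟨v, W⟩ := x
    rw [smul_apply, variationalOp_apply, variationalOp_apply]
    refine Prod.ext ?_ (ContinuousLinearMap.ext fun w => ?_) <;> simp

/-- The solution of the variational equation is the derivative of the solution in the parameters,
uniformly in time. -/
theorem exists_uniform_linear_approx_solution (hU : IsOpen U) (hT : 0 < T)
    (hA : ContDiffOn ℝ ∞ (fun p : E × ℝ => A p.1 p.2) (U ×ˢ Icc 0 T))
    (hu : ∀ y ∈ U, ∀ t ∈ Icc 0 T, HasDerivWithinAt (u y) (A y t (u y t)) (Icc 0 T) t)
    {y₀ : E} (hy₀ : y₀ ∈ U) {W : ℝ → E →L[ℝ] V}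
    (hW0 : HasFDerivAt (fun y => u y 0) (W 0) y₀)
    (hW : ∀ t ∈ Icc 0 T, HasDerivWithinAt W
      ((A y₀ t).comp (W t) + (spaceFDeriv U T A y₀ t).flip (u y₀ t)) (Icc 0 T) t)
    {ε : ℝ} (hε : 0 < ε) : ∃ δ > 0, ∀ y, ‖y - y₀‖ < δ → y ∈ U ∧ ∀ t ∈ Icc 0 T,
      ‖u y t - u y₀ t - W t (y - y₀)‖ ≤ ε * ‖y - y₀‖ := by
  have : ProperSpace E := FiniteDimensional.proper ℝ E
  have h00 : (0 : ℝ) ∈ Icc 0 T := ⟨le_rfl, hT.le⟩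
  obtain ⟨δ₀, hδ₀, hball⟩ := Metric.nhds_basis_closedBall.mem_iff.1 (hU.mem_nhds hy₀)
  obtain ⟨K, hK⟩ := ((isCompact_closedBall y₀ δ₀).prod (isCompact_Icc (a := (0 : ℝ)) (b := T))
    ).exists_bound_of_continuousOn (hA.continuousOn.mono (prod_mono hball subset_rfl))
  have hK0 : 0 ≤ K :=
    (norm_nonneg _).trans (hK (y₀, 0) ⟨Metric.mem_closedBall_self hδ₀.le, h00⟩)
  obtain ⟨M₁, hM₁⟩ := isCompact_Icc.exists_bound_of_continuousOn
    (fun t ht => (hu y₀ hy₀ t ht).continuousWithinAt : ContinuousOn (u y₀) (Icc 0 T))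
  obtain ⟨M₂, hM₂⟩ := isCompact_Icc.exists_bound_of_continuousOn
    (fun t ht => (hW t ht).continuousWithinAt : ContinuousOn W (Icc 0 T))
  have hBc : ContinuousOn (fun t => spaceFDeriv U T A y₀ t) (Icc 0 T) :=
    (contDiffOn_spaceFDeriv hU hT hA).continuousOn.comp
      (f := fun t : ℝ => (y₀, t)) (by fun_prop) (fun t ht => ⟨hy₀, ht⟩)
  obtain ⟨M₃, hM₃⟩ := isCompact_Icc.exists_bound_of_continuousOn hBc
  have hM₁0 : 0 ≤ M₁ := (norm_nonneg _).trans (hM₁ 0 h00)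
  have hM₂0 : 0 ≤ M₂ := (norm_nonneg _).trans (hM₂ 0 h00)
  have hM₃0 : 0 ≤ M₃ := (norm_nonneg _).trans (hM₃ 0 h00)
  -- The division by `C + 1` absorbs the Grönwall constant. `η` makes the Taylor error of `A`
  -- applied to `u y₀` at most `ε' / 2 * ‖w‖`, and `δ₃` below does the same for the term quadratic
  -- in `w`.
  set C := |gronwallBound 1 K 1 T| with hC
  set ε' := ε / (C + 1) with hε'
  have hε'0 : 0 < ε' := by positivity
  set η := ε' / (2 * (M₁ + 1)) with hη
  have hη0 : 0 < η := by positivity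
  obtain ⟨δ₁, hδ₁, h1⟩ := exists_uniform_linear_approx hU hT hA hy₀ hη0
  obtain ⟨δ₂, hδ₂, h2⟩ : ∃ δ > 0, ∀ y, ‖y - y₀‖ < δ →
      ‖u y 0 - u y₀ 0 - W 0 (y - y₀)‖ ≤ ε' * ‖y - y₀‖ := by
    have := (hasFDerivAt_iff_isLittleO.1 hW0).def hε'0
    obtain ⟨δ, hδ, h⟩ := Metric.eventually_nhds_iff.1 this
    exact ⟨δ, hδ, fun y hy => h (by rwa [dist_eq_norm])⟩
  set δ₃ := ε' / (2 * ((η + M₃) * M₂ + 1)) with hδ₃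
  have hδ₃0 : 0 < δ₃ := by positivity
  refine ⟨min (min δ₀ δ₁) (min δ₂ δ₃), by positivity, fun y hy => ?_⟩
  have hy0 : ‖y - y₀‖ < δ₀ := hy.trans_le ((min_le_left _ _).trans (min_le_left _ _))
  have hy1 : ‖y - y₀‖ < δ₁ := hy.trans_le ((min_le_left _ _).trans (min_le_right _ _))
  have hy2 : ‖y - y₀‖ < δ₂ := hy.trans_le ((min_le_right _ _).trans (min_le_left _ _))
  have hy3 : ‖y - y₀‖ < δ₃ := hy.trans_le ((min_le_right _ _).trans (min_le_right _ _))
  have hyball : y ∈ Metric.closedBall y₀ δ₀ := by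
    rw [Metric.mem_closedBall, dist_eq_norm]; exact hy0.le
  have hyU : y ∈ U := hball hyball
  refine ⟨hyU, ?_⟩
  set w := y - y₀ with hw
  have hder : ∀ t ∈ Icc 0 T, HasDerivWithinAt (fun t => u y t - u y₀ t - W t w)
      (A y t (u y t) - A y₀ t (u y₀ t) -
        ((A y₀ t).comp (W t) + (spaceFDeriv U T A y₀ t).flip (u y₀ t)) w) (Icc 0 T) t := by
    intro t ht
    refine ((hu y hyU t ht).sub (hu y₀ hy₀ t ht)).sub ?_
    exact ((ContinuousLinearMap.apply ℝ V w).hasFDerivAt.comp_hasDerivWithinAt t (hW t ht))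
  have hbound := norm_le_of_norm_deriv_le (ε := ε' * ‖w‖) hK0 (by positivity) hder (h2 y hy2) ?_
  · intro t ht
    refine (hbound t ht).trans ?_
    have : gronwallBound 1 K 1 T * ε' ≤ ε := by
      rw [hε', mul_div_assoc', div_le_iff₀ (by positivity)]
      have := le_abs_self (gronwallBound 1 K 1 T)
      nlinarith
    calc gronwallBound 1 K 1 T * (ε' * ‖w‖) = gronwallBound 1 K 1 T * ε' * ‖w‖ := by ring
      _ ≤ ε * ‖w‖ := mul_le_mul_of_nonneg_right this (norm_nonneg _)
  · intro t ht
    -- The remainder satisfies the linear equation at `y` with an inhomogeneity of two parts: the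
    -- Taylor remainder of `A` acting on `u y₀`, and the increment of `A` acting on `W w`.
    have hid : A y t (u y t) - A y₀ t (u y₀ t) -
        ((A y₀ t).comp (W t) + (spaceFDeriv U T A y₀ t).flip (u y₀ t)) w =
        A y t (u y t - u y₀ t - W t w) +
        ((A y t - A y₀ t - spaceFDeriv U T A y₀ t w) (u y₀ t) +
        (A y t - A y₀ t) (W t w)) := by
      simp only [add_apply, ContinuousLinearMap.comp_apply,
        ContinuousLinearMap.flip_apply, sub_apply, map_sub]
      abel
    have e1 := h1 y hy1 t ht
    have e2 : ‖A y t - A y₀ t‖ ≤ (η + M₃) * ‖w‖ := by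
      have : A y t - A y₀ t = (A y t - A y₀ t - spaceFDeriv U T A y₀ t w)
          + spaceFDeriv U T A y₀ t w := by abel
      rw [this, add_mul]
      refine (norm_add_le _ _).trans (add_le_add e1 ?_)
      exact ((spaceFDeriv U T A y₀ t).le_opNorm _).trans
        (mul_le_mul_of_nonneg_right (hM₃ t ht) (norm_nonneg _))
    have e3 : ‖(A y t - A y₀ t - spaceFDeriv U T A y₀ t w) (u y₀ t)‖ ≤ ε' / 2 * ‖w‖ := by
      refine (ContinuousLinearMap.le_opNorm _ _).trans ((mul_le_mul e1 (hM₁ t ht) (norm_nonneg _)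
        (by positivity)).trans ?_)
      have : η * M₁ ≤ ε' / 2 := by
        rw [hη, div_mul_eq_mul_div, div_le_div_iff₀ (by positivity) (by positivity)]
        nlinarith
      calc η * ‖w‖ * M₁ = η * M₁ * ‖w‖ := by ring
        _ ≤ _ := mul_le_mul_of_nonneg_right this (norm_nonneg _)
    have e4 : ‖(A y t - A y₀ t) (W t w)‖ ≤ ε' / 2 * ‖w‖ := by
      have e5 : ‖W t w‖ ≤ M₂ * ‖w‖ := ((W t).le_opNorm _).trans
        (mul_le_mul_of_nonneg_right (hM₂ t ht) (norm_nonneg _))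
      refine (ContinuousLinearMap.le_opNorm _ _).trans ((mul_le_mul e2 e5 (norm_nonneg _)
        (by positivity)).trans ?_)
      have e6 : (η + M₃) * M₂ * ‖w‖ ≤ ε' / 2 := by
        have e7 : (η + M₃) * M₂ * δ₃ ≤ ε' / 2 := by
          have hp : 0 ≤ (η + M₃) * M₂ := by positivity
          rw [hδ₃, mul_div_assoc', div_le_div_iff₀ (by positivity) (by positivity)]
          nlinarith
        exact (mul_le_mul_of_nonneg_left hy3.le (by positivity)).trans e7
      calc (η + M₃) * ‖w‖ * (M₂ * ‖w‖) = (η + M₃) * M₂ * ‖w‖ * ‖w‖ := by ring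
        _ ≤ _ := mul_le_mul_of_nonneg_right e6 (norm_nonneg _)
    rw [hid]
    refine (norm_add_le _ _).trans (add_le_add (((A y t).le_opNorm _).trans
      (mul_le_mul_of_nonneg_right (hK (y, t) ⟨hyball, ht⟩) (norm_nonneg _))) ?_)
    refine (norm_add_le _ _).trans ((add_le_add e3 e4).trans (le_of_eq (by ring)))

/-- Write `u y t` as `(u y t - u y₀ t) + u y₀ t`. The second summand is differentiated by the
equation; for the first, the linear approximation is uniform in time, and continuity of `W` allows
`W t` to be replaced by `W t₀`. -/
theorem hasFDerivWithinAt_linearODE_solution (hU : IsOpen U) (hT : 0 < T)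
    (hA : ContDiffOn ℝ ∞ (fun p : E × ℝ => A p.1 p.2) (U ×ˢ Icc 0 T))
    (hu : ∀ y ∈ U, ∀ t ∈ Icc 0 T, HasDerivWithinAt (u y) (A y t (u y t)) (Icc 0 T) t)
    {y₀ : E} (hy₀ : y₀ ∈ U) {W : ℝ → E →L[ℝ] V}
    (hW0 : HasFDerivAt (fun y => u y 0) (W 0) y₀)
    (hW : ∀ t ∈ Icc 0 T, HasDerivWithinAt W
      ((A y₀ t).comp (W t) + (spaceFDeriv U T A y₀ t).flip (u y₀ t)) (Icc 0 T) t)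
    {t₀ : ℝ} (ht₀ : t₀ ∈ Icc 0 T) :
    HasFDerivWithinAt (fun p : E × ℝ => u p.1 p.2)
      ((W t₀).comp (ContinuousLinearMap.fst ℝ E ℝ) +
        (ContinuousLinearMap.toSpanSingleton ℝ (A y₀ t₀ (u y₀ t₀))).comp
          (ContinuousLinearMap.snd ℝ E ℝ)) (U ×ˢ Icc 0 T) (y₀, t₀) := by
  have h1 : HasFDerivWithinAt (fun p : E × ℝ => u y₀ p.2)
      ((ContinuousLinearMap.toSpanSingleton ℝ (A y₀ t₀ (u y₀ t₀))).comp
          (ContinuousLinearMap.snd ℝ E ℝ)) (U ×ˢ Icc 0 T) (y₀, t₀) :=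
    HasFDerivWithinAt.comp (y₀, t₀) (hu y₀ hy₀ t₀ ht₀).hasFDerivWithinAt
      (hasFDerivWithinAt_snd (s := U ×ˢ Icc 0 T)) (fun p hp => hp.2)
  have h2 : HasFDerivWithinAt (fun p : E × ℝ => u p.1 p.2 - u y₀ p.2)
      ((W t₀).comp (ContinuousLinearMap.fst ℝ E ℝ)) (U ×ˢ Icc 0 T) (y₀, t₀) := by
    refine HasFDerivWithinAt.of_isLittleO (Asymptotics.isLittleO_iff.2 fun c hc => ?_)
    obtain ⟨δ, hδ, hd⟩ := exists_uniform_linear_approx_solution hU hT hA hu hy₀ hW0 hW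
      (half_pos hc)
    have hWc : Filter.Tendsto W (nhdsWithin t₀ (Icc 0 T)) (nhds (W t₀)) :=
      (hW t₀ ht₀).continuousWithinAt
    have hs : Filter.Tendsto (fun p : E × ℝ => p.2) (nhdsWithin (y₀, t₀) (U ×ˢ Icc 0 T))
        (nhdsWithin t₀ (Icc 0 T)) :=
      (continuous_snd.continuousWithinAt (x := (y₀, t₀))).tendsto_nhdsWithin fun p hp => hp.2
    have hW' := (hWc.comp hs).eventually (Metric.ball_mem_nhds _ (half_pos hc))
    have hfst : ∀ᶠ p : E × ℝ in nhdsWithin (y₀, t₀) (U ×ˢ Icc 0 T), p.1 ∈ Metric.ball y₀ δ :=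
      (continuous_fst.continuousWithinAt (x := (y₀, t₀))).eventually_mem
        (Metric.ball_mem_nhds _ hδ)
    filter_upwards [hW', hfst, self_mem_nhdsWithin] with p hp1 hp2 hp3
    have hp2' : ‖p.1 - y₀‖ < δ := by rwa [← dist_eq_norm]
    have hle : ‖p.1 - y₀‖ ≤ ‖p - (y₀, t₀)‖ := norm_fst_le (p - (y₀, t₀))
    have e1 := (hd p.1 hp2').2 p.2 hp3.2
    have e2 : ‖(W p.2 - W t₀) (p.1 - y₀)‖ ≤ c / 2 * ‖p.1 - y₀‖ := by
      refine (ContinuousLinearMap.le_opNorm _ _).trans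
        (mul_le_mul_of_nonneg_right ?_ (norm_nonneg _))
      rw [← dist_eq_norm]
      exact le_of_lt hp1
    have hid : u p.1 p.2 - u y₀ p.2 - (u (y₀, t₀).1 (y₀, t₀).2 - u y₀ (y₀, t₀).2) -
        ((W t₀).comp (ContinuousLinearMap.fst ℝ E ℝ)) (p - (y₀, t₀)) =
        (u p.1 p.2 - u y₀ p.2 - W p.2 (p.1 - y₀)) + (W p.2 - W t₀) (p.1 - y₀) := by
      simp
    rw [hid]
    refine (norm_add_le _ _).trans ((add_le_add e1 e2).trans ?_)
    rw [← add_mul, add_halves]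
    exact mul_le_mul_of_nonneg_left hle hc.le
  refine HasFDerivWithinAt.congr (h2.add h1) (fun p _ => ?_) ?_ <;> simp

end Parameters

universe v

/-- The pair `(u, W)` of the solution and its parameter derivative solves a linear equation of the
same kind, with smooth coefficients and initial values. By induction it is of class `C^k`; the
derivative of `u` is expressed by `W` and `A u`, so `u` is of class `C^{k+1}`. The space `V` changes
in the induction, and one universe for `E` and `V` keeps `V × (E →L[ℝ] V)` in range. -/
theorem contDiffOn_nat_linearODE_solution {E : Type v} [NormedAddCommGroup E] [NormedSpace ℝ E]
    [FiniteDimensional ℝ E] {U : Set E} {T : ℝ} (hU : IsOpen U) (hT : 0 < T) (k : ℕ)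
    {V : Type v} [NormedAddCommGroup V] [NormedSpace ℝ V] [FiniteDimensional ℝ V]
    {A : E → ℝ → V →L[ℝ] V} {u : E → ℝ → V}
    (hA : ContDiffOn ℝ ∞ (fun p : E × ℝ => A p.1 p.2) (U ×ˢ Icc 0 T))
    (hu : ∀ y ∈ U, ∀ t ∈ Icc 0 T, HasDerivWithinAt (u y) (A y t (u y t)) (Icc 0 T) t)
    (hu0 : ContDiffOn ℝ ∞ (fun y => u y 0) U) :
    ContDiffOn ℝ k (fun p : E × ℝ => u p.1 p.2) (U ×ˢ Icc 0 T) := by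
  have hBs := fun {V : Type v} [NormedAddCommGroup V] [NormedSpace ℝ V] {A : E → ℝ → V →L[ℝ] V}
    (hA : ContDiffOn ℝ ∞ (fun p : E × ℝ => A p.1 p.2) (U ×ˢ Icc 0 T)) =>
    contDiffOn_spaceFDeriv hU hT hA
  have hex : ∀ {V : Type v} [NormedAddCommGroup V] [NormedSpace ℝ V] [FiniteDimensional ℝ V]
      {A : E → ℝ → V →L[ℝ] V} {u : E → ℝ → V},
      ContDiffOn ℝ ∞ (fun p : E × ℝ => A p.1 p.2) (U ×ˢ Icc 0 T) →
      (∀ y ∈ U, ∀ t ∈ Icc 0 T, HasDerivWithinAt (u y) (A y t (u y t)) (Icc 0 T) t) →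
      ∀ y, ∃ W : ℝ → E →L[ℝ] V, y ∈ U → W 0 = fderiv ℝ (fun y => u y 0) y ∧
      ∀ t ∈ Icc 0 T, HasDerivWithinAt W
      ((A y t).comp (W t) + (spaceFDeriv U T A y t).flip (u y t)) (Icc 0 T) t := by
    intro V _ _ _ A u hA hu y
    by_cases hy : y ∈ U
    · have hc : ContinuousOn (fun t : ℝ => (y, t)) (Icc 0 T) := by fun_prop
      have hAc : ContinuousOn (fun t => A y t) (Icc 0 T) :=
        hA.continuousOn.comp hc (fun t ht => ⟨hy, ht⟩)
      have hBc : ContinuousOn (fun t => spaceFDeriv U T A y t) (Icc 0 T) :=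
        (hBs hA).continuousOn.comp hc (fun t ht => ⟨hy, ht⟩)
      have huc : ContinuousOn (u y) (Icc 0 T) := fun t ht => (hu y hy t ht).continuousWithinAt
      obtain ⟨W, hW0, hW⟩ := exists_linearODE_solution hT.le
        (A := fun t => ContinuousLinearMap.compL ℝ E V V (A y t))
        (h := fun t => (spaceFDeriv U T A y t).flip (u y t))
        ((ContinuousLinearMap.compL ℝ E V V).continuous.comp_continuousOn hAc)
        (((ContinuousLinearMap.flipₗᵢ ℝ E V V).continuous.comp_continuousOn hBc).clm_apply huc)
        (fderiv ℝ (fun y => u y 0) y)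
      exact ⟨W, fun _ => ⟨hW0, hW⟩⟩
    · exact ⟨0, fun h => (hy h).elim⟩
  induction k generalizing V with
  | zero =>
    choose W hW using hex hA hu
    rw [Nat.cast_zero, contDiffOn_zero]
    intro p hp
    refine (hasFDerivWithinAt_linearODE_solution hU hT hA hu hp.1 (W := W p.1) ?_
      (hW p.1 hp.1).2 hp.2).continuousWithinAt
    rw [(hW p.1 hp.1).1]
    exact ((hu0.contDiffAt (hU.mem_nhds hp.1)).differentiableAt (by simp)).hasFDerivAt
  | succ k ih =>
    choose W hW using hex hA hu
    have hA' : ContDiffOn ℝ ∞ (fun p : E × ℝ =>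
        variationalOp (A p.1 p.2) (spaceFDeriv U T A p.1 p.2)) (U ×ˢ Icc 0 T) :=
      contDiff_variationalOp.comp_contDiffOn (hA.prodMk (hBs hA))
    have hpair := ih (V := V × (E →L[ℝ] V)) (A := fun y t => variationalOp (A y t) (spaceFDeriv U T A y t))
      (u := fun y t => (u y t, W y t)) hA'
      (fun y hy t ht => by
        rw [variationalOp_apply]
        exact (hu y hy t ht).prodMk ((hW y hy).2 t ht))
      (hu0.prodMk ((hu0.fderiv_of_isOpen hU (m := ∞) (by simp)).congr fun y hy => (hW y hy).1))
    have hku := hpair.fst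
    have hkW := hpair.snd
    rw [Nat.cast_succ, contDiffOn_succ_iff_hasFDerivWithinAt_of_uniqueDiffOn
      (uniqueDiffOn_ST hU hT)]
    refine ⟨fun h => by simp at h, fun p => (W p.1 p.2).comp (ContinuousLinearMap.fst ℝ E ℝ) +
        (ContinuousLinearMap.toSpanSingleton ℝ (A p.1 p.2 (u p.1 p.2))).comp
          (ContinuousLinearMap.snd ℝ E ℝ), ?_, fun p hp => ?_⟩
    · refine (hkW.clm_comp contDiffOn_const).add (ContDiffOn.clm_comp ?_ contDiffOn_const)
      exact (ContinuousLinearMap.toSpanSingletonCLE (𝕜 := ℝ) (E := V)).contDiff.comp_contDiffOn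
        ((hA.of_le (by exact_mod_cast le_top)).clm_apply hku)
    · refine hasFDerivWithinAt_linearODE_solution hU hT hA hu hp.1 (W := W p.1) ?_
        (hW p.1 hp.1).2 hp.2
      rw [(hW p.1 hp.1).1]
      exact ((hu0.contDiffAt (hU.mem_nhds hp.1)).differentiableAt (by simp)).hasFDerivAt

/-- Solutions of linear differential equations depend smoothly on parameters. -/
theorem contDiffOn_linearODE_solution {E : Type v} [NormedAddCommGroup E] [NormedSpace ℝ E]
    [FiniteDimensional ℝ E] {U : Set E} {T : ℝ} (hU : IsOpen U) (hT : 0 < T)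
    {V : Type v} [NormedAddCommGroup V] [NormedSpace ℝ V] [FiniteDimensional ℝ V]
    {A : E → ℝ → V →L[ℝ] V} {u : E → ℝ → V}
    (hA : ContDiffOn ℝ ∞ (fun p : E × ℝ => A p.1 p.2) (U ×ˢ Icc 0 T))
    (hu : ∀ y ∈ U, ∀ t ∈ Icc 0 T, HasDerivWithinAt (u y) (A y t (u y t)) (Icc 0 T) t)
    (hu0 : ContDiffOn ℝ ∞ (fun y => u y 0) U) :
    ContDiffOn ℝ ∞ (fun p : E × ℝ => u p.1 p.2) (U ×ˢ Icc 0 T) :=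
  contDiffOn_infty.2 fun k => contDiffOn_nat_linearODE_solution hU hT k hA hu hu0

end LinearODE

/-! ### The theorem in a coordinate domain. -/

section LocalStatement

set_option linter.unusedSectionVars false

universe v

variable {E : Type v} [NormedAddCommGroup E] [NormedSpace ℝ E] {ι : Type v} [Fintype ι]
  [DecidableEq ι] {U : Set E} {T : ℝ} {b : Module.Basis ι ℝ E} {τ : ι → Bool}
  {G : E → ℝ → Matrix ι ι ℝ}

/-- The commutator with a fixed matrix. -/
noncomputable def commutatorOp (R : ι → ι → ℝ) : (ι → ι → ℝ) →L[ℝ] (ι → ι → ℝ) :=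
  LinearMap.toContinuousLinearMap
    { toFun := fun X i j => ∑ c, R i c * X c j - ∑ c, X i c * R c j
      map_add' := fun X Y => by
        ext i j
        simp only [Pi.add_apply, mul_add, add_mul, Finset.sum_add_distrib]
        ring
      map_smul' := fun c X => by
        ext i j
        simp only [Pi.smul_apply, smul_eq_mul, RingHom.id_apply, mul_sub, Finset.mul_sum]
        congr 1 <;> exact Finset.sum_congr rfl fun _ _ => by ring }

omit [DecidableEq ι] in
theorem commutatorOp_apply (R X : ι → ι → ℝ) (i j : ι) :
    commutatorOp R X i j = ∑ c, R i c * X c j - ∑ c, X i c * R c j := rfl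

omit [DecidableEq ι] in
theorem contDiff_commutatorOp : ContDiff ℝ ∞ (commutatorOp (ι := ι)) := by
  refine contDiff_of_finiteDimensional (fun R R' => ?_) (fun c R => ?_)
  · ext X i j
    simp only [add_apply, commutatorOp_apply, Pi.add_apply, mul_add, add_mul,
      Finset.sum_add_distrib]
    ring
  · ext X i j
    simp only [smul_apply, commutatorOp_apply, Pi.smul_apply, smul_eq_mul, mul_sub,
      Finset.mul_sum]
    congr 1 <;> exact Finset.sum_congr rfl fun _ _ => by ring

/-- Solutions of the projection equation with constant initial values are smooth. -/
theorem SmoothOn.of_projectionODE [FiniteDimensional ℝ E] (hU : IsOpen U) (hT : 0 < T)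
    {R P : E → ℝ → Matrix ι ι ℝ} (hR : ∀ i j, SmoothOn U T (fun y t => R y t i j))
    {P₀ : Matrix ι ι ℝ} (hP0 : ∀ y ∈ U, P y 0 = P₀)
    (hode : ∀ y ∈ U, ∀ t ∈ Icc 0 T, ∀ i j, HasDerivWithinAt (fun s => P y s i j)
      ((R y t * P y t - P y t * R y t) i j) (Icc 0 T) t) (i j : ι) :
    SmoothOn U T (fun y t => P y t i j) := by
  have hRs : ContDiffOn ℝ ∞ (fun p : E × ℝ => (fun i j => R p.1 p.2 i j : ι → ι → ℝ))
      (U ×ˢ Icc 0 T) := contDiffOn_pi.2 fun i => contDiffOn_pi.2 fun j => hR i j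
  have h := contDiffOn_linearODE_solution hU hT (V := ι → ι → ℝ)
    (A := fun y t => commutatorOp (fun i j => R y t i j)) (u := fun y t i j => P y t i j)
    (contDiff_commutatorOp.comp_contDiffOn hRs)
    (fun y hy t ht => hasDerivWithinAt_pi.2 fun i => hasDerivWithinAt_pi.2 fun j => by
      have := hode y hy t ht i j
      rw [Matrix.sub_apply, Matrix.mul_apply, Matrix.mul_apply] at this
      exact this)
    ((contDiffOn_const (c := fun i j => P₀ i j)).congr fun y hy => by
      funext i j
      rw [hP0 y hy])
  exact contDiffOn_pi.1 (contDiffOn_pi.1 h i) j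

/-- The statement in a coordinate domain. -/
theorem Dt_iterate_nablaIter_eq_zero [FiniteDimensional ℝ E] (hU : IsOpen U) (hT : 0 < T)
    (hG : ∀ i j, SmoothOn U T (fun y t => G y t i j))
    (hdet : ∀ y ∈ U, ∀ t ∈ Icc 0 T, (G y t).det ≠ 0)
    (hflow : ∀ y ∈ U, ∀ t ∈ Icc 0 T, ∀ i j, HasDerivWithinAt (fun s => G y s i j)
      (-2 * ricci b G y t i j) (Icc 0 T) t)
    (hmixed : ∀ i j, τ i ≠ τ j → ∀ y ∈ U, G y 0 i j = 0)
    (hindep : ∀ a i j, τ i = τ j → τ a ≠ τ i → ∀ y ∈ U, pd b a (fun z => G z 0 i j) y = 0)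
    {Ph Pc : E → ℝ → Matrix ι ι ℝ} (hPh0 : ∀ y ∈ U, Ph y 0 = factorProj τ true)
    (hPc0 : ∀ y ∈ U, Pc y 0 = factorProj τ false)
    (hPh : ∀ y ∈ U, ∀ t ∈ Icc 0 T, ∀ i j, HasDerivWithinAt (fun s => Ph y s i j)
      ((ricciEnd b G y t * Ph y t - Ph y t * ricciEnd b G y t) i j) (Icc 0 T) t)
    (hPc : ∀ y ∈ U, ∀ t ∈ Icc 0 T, ∀ i j, HasDerivWithinAt (fun s => Pc y s i j)
      ((ricciEnd b G y t * Pc y t - Pc y t * ricciEnd b G y t) i j) (Icc 0 T) t)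
    {y : E} (hy : y ∈ U) (k l : ℕ) :
    ((Dt b G T)^[k] (nablaIter b G (calR b G Ph Pc) l)) y 0 = 0 ∧
    ((Dt b G T)^[k] (nablaIter b G (calP Ph Pc) (l + 1))) y 0 = 0 := by
  have hv0 : ∀ i j, τ i ≠ τ j → VanishTo U T 0 (fun y t => G y t i j) := fun i j h =>
    ⟨hG i j, hmixed i j h⟩
  have hS0 : ∀ i j, SplitTo U T b τ 0 [i, j] (fun y t => G y t i j) := by
    -- If `i, j` are mixed, the component is zero on all of `U` at time zero and so are its
    -- derivatives; if not, `a` lies in the other factor and `hindep` applies.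
    refine fun i j => ⟨hG i j, fun h => hv0 i j (not_homogeneous_pair h), fun a ha => ?_⟩
    by_cases hij : τ i = τ j
    · refine ⟨(hG i j).dx hU hT _, hindep a i j hij fun hai => ha ?_⟩
      simp [Homogeneous, hai, hij]
    · exact (hv0 i j hij).dx hU hT _
  have hS := SplitTo.of_flow hU hT hdet
    (fun i j y hy t ht => (hflow y hy t ht i j).derivWithin (uniqueDiffOn_Icc hT t ht)) hS0
  have hRE := fun i j => (SplitTo.ricciEnd hU hT hdet (hS 0) i j).smooth
  have hP : ∀ {s : Bool} {P : E → ℝ → Matrix ι ι ℝ}, (∀ y ∈ U, P y 0 = factorProj τ s) →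
      (∀ y ∈ U, ∀ t ∈ Icc 0 T, ∀ i j, HasDerivWithinAt (fun s => P y s i j)
      ((ricciEnd b G y t * P y t - P y t * ricciEnd b G y t) i j) (Icc 0 T) t) →
      ∀ i j, Flat U T (fun y t => P y t i j - factorProj τ s i j) := fun h0 hode =>
    Flat.of_projectionODE hU hT hdet hS _ (SmoothOn.of_projectionODE hU hT hRE h0 hode) h0
      fun i j y hy t ht => (hode y hy t ht i j).derivWithin (uniqueDiffOn_Icc hT t ht)
  have hΓ := fun l i j => (SplitTo.christoffel hU hT hdet (hS 0) l i j).smooth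
  have hR := fun i j => (SplitTo.ricci hU hT hdet (hS 0) i j).smooth
  have hI := SmoothOn.inv hG hdet
  exact ⟨(((TensorFlat.calR hU hT hdet hS (hP hPh0 hPh) (hP hPc0 hPc)).nablaIter hU hT hΓ
      l).Dt_iterate hU hT hR hI k).apply_zero hy,
    (((TensorFlat.nabla_calP hU hT hdet hS (hP hPh0 hPh) (hP hPc0 hPc)).nablaIter_succ hU hT hΓ
      l).Dt_iterate hU hT hR hI k).apply_zero hy⟩

end LocalStatement

/-! ### Components in a chart: smoothness and nondegeneracy. -/

section ChartComponents

set_option linter.unusedSectionVars false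

variable {E : Type*} [NormedAddCommGroup E] [NormedSpace ℝ E]
  {H : Type*} [TopologicalSpace H] {I : ModelWithCorners ℝ E H} [I.Boundaryless]
  {N : Type*} [TopologicalSpace N] [ChartedSpace H N] [IsManifold I ∞ N]
  {ι : Type*} {e : OpenPartialHomeomorph N H}

theorem contMDiffOn_extend_symm_target (he : e ∈ IsManifold.maximalAtlas I ∞ N) :
    ContMDiffOn 𝓘(ℝ, E) I ∞ (e.extend I).symm (e.extend I).target := by
  rw [e.extend_target']
  exact contMDiffOn_extend_symm he

theorem mdifferentiableAt_extend_symm (he : e ∈ IsManifold.maximalAtlas I ∞ N) {y : E}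
    (hy : y ∈ (e.extend I).target) : MDifferentiableAt 𝓘(ℝ, E) I (e.extend I).symm y :=
  ((contMDiffOn_extend_symm_target he).contMDiffAt
    (e.isOpen_extend_target.mem_nhds hy)).mdifferentiableAt (by simp)

theorem mfderiv_extend_coordVec (he : e ∈ IsManifold.maximalAtlas I ∞ N) {y : E}
    (hy : y ∈ (e.extend I).target) (v : E) :
    mfderiv I 𝓘(ℝ, E) (e.extend I) ((e.extend I).symm y) (coordVec I e y v) = v := by
  have hsrc : (e.extend I).symm y ∈ e.source := by
    rw [← e.extend_source (I := I)]
    exact (e.extend I).map_target hy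
  have h1 : MDifferentiableAt I 𝓘(ℝ, E) (e.extend I) ((e.extend I).symm y) :=
    (e.contMDiffAt_extend he hsrc).mdifferentiableAt (by simp)
  have h2 := mfderiv_comp y h1 (mdifferentiableAt_extend_symm he hy)
  have h3 : (e.extend I) ∘ (e.extend I).symm =ᶠ[nhds y] id := by
    filter_upwards [e.isOpen_extend_target.mem_nhds hy] with z hz
    exact (e.extend I).right_inv hz
  rw [h3.mfderiv_eq, mfderiv_id] at h2
  exact (DFunLike.congr_fun h2 v).symm

theorem coordVec_injective (he : e ∈ IsManifold.maximalAtlas I ∞ N) {y : E}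
    (hy : y ∈ (e.extend I).target) {v : E} (hv : coordVec I e y v = 0) : v = 0 := by
  rw [← mfderiv_extend_coordVec he hy v, hv]
  exact map_zero _

/-- The coordinate field is the tangent map of the inverse chart composed with the constant section
`v`. -/
theorem contMDiffOn_coordVec (he : e ∈ IsManifold.maximalAtlas I ∞ N) (v : E) :
    ContMDiffOn 𝓘(ℝ, E) I.tangent ∞
      (fun y => (⟨(e.extend I).symm y, coordVec I e y v⟩ : TangentBundle I N))
      (e.extend I).target := by
  have : IsManifold I 1 N := IsManifold.of_le (n := ∞) (by simp)
  have hU := e.isOpen_extend_target (I := I)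
  have h1 := (contMDiffOn_extend_symm_target he).contMDiffOn_tangentMapWithin (m := ∞) (by simp)
    hU.uniqueMDiffOn
  have h2 : ContMDiffOn 𝓘(ℝ, E) 𝓘(ℝ, E).tangent ∞
      (fun y => (⟨y, v⟩ : TangentBundle 𝓘(ℝ, E) E)) (e.extend I).target :=
    contMDiffOn_vectorSpace_iff_contDiffOn.2 contDiffOn_const
  refine (h1.comp h2 (fun y hy => hy)).congr fun y hy => ?_
  simp only [Function.comp, tangentMapWithin, mfderivWithin_of_isOpen hU hy]
  rfl

variable {b : Module.Basis ι ℝ E} {T : ℝ}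
  {g : ℝ → ContMDiffRiemannianMetric I ∞ E (fun x : N => TangentSpace I x)}

/-- The components of a family of metrics, smooth in space and time, are smooth. -/
theorem smoothOn_metricComp (he : e ∈ IsManifold.maximalAtlas I ∞ N)
    (hg : ContMDiffOn (I.prod 𝓘(ℝ, ℝ)) (I.prod 𝓘(ℝ, E →L[ℝ] E →L[ℝ] ℝ)) ∞
      (fun z : N × ℝ => TotalSpace.mk' (E →L[ℝ] E →L[ℝ] ℝ)
        (E := fun x : N => TangentSpace I x →L[ℝ] TangentSpace I x →L[ℝ] ℝ)
        z.1 ((g z.2).inner z.1))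
      (Set.univ ×ˢ Set.Icc 0 T)) (i j : ι) :
    SmoothOn (e.extend I).target T (fun y t => metricComp I b g e y t i j) := by
  have hfst : ContMDiffOn 𝓘(ℝ, E × ℝ) 𝓘(ℝ, E) ∞ (fun p : E × ℝ => p.1)
      ((e.extend I).target ×ˢ Icc 0 T) := contDiff_fst.contMDiff.contMDiffOn
  have hsnd : ContMDiffOn 𝓘(ℝ, E × ℝ) 𝓘(ℝ, ℝ) ∞ (fun p : E × ℝ => p.2)
      ((e.extend I).target ×ˢ Icc 0 T) := contDiff_snd.contMDiff.contMDiffOn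
  have hφ := (contMDiffOn_extend_symm_target he).comp hfst fun p hp => hp.1
  have hψ := hg.comp (hφ.prodMk hsnd) fun p hp => ⟨mem_univ _, hp.2⟩
  have hv := fun v => (contMDiffOn_coordVec he v).comp hfst fun p hp => hp.1
  intro p hp
  -- A smooth section of bilinear forms is evaluated on two smooth coordinate fields; the result is
  -- a section of a trivial line bundle, whose fibre part is the component.
  have : ContMDiffWithinAt 𝓘(ℝ, E × ℝ) (I.prod 𝓘(ℝ)) ∞
      (fun p : E × ℝ => TotalSpace.mk' ℝ (E := Bundle.Trivial N ℝ) ((e.extend I).symm p.1)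
        ((g p.2).inner ((e.extend I).symm p.1) (coordVec I e p.1 (b i)) (coordVec I e p.1 (b j))))
      ((e.extend I).target ×ˢ Icc 0 T) p := by
    apply ContMDiffWithinAt.clm_bundle_apply₂ (F₁ := E) (F₂ := E)
    · exact hψ p hp
    · exact hv (b i) p hp
    · exact hv (b j) p hp
  simp only [contMDiffWithinAt_totalSpace] at this
  exact contMDiffWithinAt_iff_contDiffWithinAt.1 this.2

/-- A null vector of the matrix would give coordinates of a tangent vector with `g(v, v) = 0`, which
positivity excludes. -/
theorem det_metricComp_ne_zero [Fintype ι] [DecidableEq ι]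
    (he : e ∈ IsManifold.maximalAtlas I ∞ N) {y : E} (hy : y ∈ (e.extend I).target) (t : ℝ) :
    (metricComp I b g e y t).det ≠ 0 := by
  intro h
  obtain ⟨v, hv, hGv⟩ := Matrix.exists_mulVec_eq_zero_iff.2 h
  let L : E →L[ℝ] TangentSpace I ((e.extend I).symm y) := mfderiv 𝓘(ℝ, E) I (e.extend I).symm y
  have h0 : (g t).inner ((e.extend I).symm y) (L (∑ i, v i • b i)) (L (∑ i, v i • b i)) = 0 := by
    have h1 : ∀ i, (g t).inner ((e.extend I).symm y) (L (b i)) (L (∑ j, v j • b j)) = 0 := by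
      intro i
      have := congrFun hGv i
      simp only [Matrix.mulVec, dotProduct, metricComp, Matrix.of_apply, Pi.zero_apply] at this
      rw [map_sum, map_sum, ← this]
      refine Finset.sum_congr rfl fun j _ => ?_
      rw [map_smul, map_smul, smul_eq_mul, mul_comm]
      rfl
    nth_rewrite 1 [map_sum]
    rw [map_sum, sum_apply]
    refine Finset.sum_eq_zero fun i _ => ?_
    rw [map_smul, map_smul, smul_apply, h1, smul_zero]
  have h2 : L (∑ i, v i • b i) = 0 := by
    by_contra hne
    exact (((g t).pos _ _ hne).ne') h0
  have h3 := coordVec_injective he hy (v := ∑ i, v i • b i) h2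
  exact hv (funext fun i => Fintype.linearIndependent_iff.1 b.linearIndependent v h3 i)

end ChartComponents

/-- No differentiability is needed: where `f` is not differentiable, `fderiv` is zero by convention.
-/
theorem fderiv_eq_zero_of_eventually_const {E : Type*} [NormedAddCommGroup E] [NormedSpace ℝ E]
    {f : E → ℝ} {y v : E} (h : ∀ᶠ s : ℝ in nhds 0, f (y + s • v) = f y) : fderiv ℝ f y v = 0 := by
  by_cases hf : DifferentiableAt ℝ f y
  · rw [← hf.lineDeriv_eq_fderiv, lineDeriv, Filter.EventuallyEq.deriv_eq h]
    simp
  · simp [fderiv_zero_of_not_differentiableAt hf]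

/-! ### Orthogonal projections and their components. -/

section OrthogonalProjection

variable {V : Type*} [AddCommGroup V] [Module ℝ V] [TopologicalSpace V] {B : V →L[ℝ] V →L[ℝ] ℝ}
  {K : Submodule ℝ V} {P : V →L[ℝ] V}

/-- `v - P v` lies in `K` and is orthogonal to `K`, hence to itself. -/
theorem IsOrthProj.apply_of_mem (hB : ∀ v, v ≠ 0 → 0 < B v v) (hP : IsOrthProj B K P) {v : V}
    (hv : v ∈ K) : P v = v := by
  by_contra hne
  have h1 : v - P v ≠ 0 := fun h => hne (sub_eq_zero.1 h).symm
  exact (hB _ h1).ne' ((hP v).2 _ (K.sub_mem hv (hP v).1))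

theorem IsOrthProj.apply_of_orthogonal (hB : ∀ v, v ≠ 0 → 0 < B v v) (hP : IsOrthProj B K P) {v : V}
    (hv : ∀ w ∈ K, B v w = 0) : P v = 0 := by
  by_contra hne
  have h1 := (hP v).2 _ (hP v).1
  rw [map_sub, sub_apply, hv _ (hP v).1, zero_sub, neg_eq_zero] at h1
  exact (hB _ hne).ne' h1

end OrthogonalProjection

section OrthogonalProjectionComponents

variable {E : Type*} [NormedAddCommGroup E] [NormedSpace ℝ E]
  {H : Type*} [TopologicalSpace H] {I : ModelWithCorners ℝ E H}
  {N : Type*} [TopologicalSpace N] [ChartedSpace H N] {e : OpenPartialHomeomorph N H}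

theorem coordVec_zero (e : OpenPartialHomeomorph N H) (y : E) :
    coordVec I e y 0 = 0 := map_zero (mfderiv 𝓘(ℝ, E) I (e.extend I).symm y)

/-- The components of the orthogonal projection onto a subspace which is spanned by coordinate
vectors and orthogonal to the other coordinate vectors. -/
theorem endComp_eq_factorProj [I.Boundaryless] [IsManifold I ∞ N] {ι : Type*} [Fintype ι]
    [DecidableEq ι] {b : Module.Basis ι ℝ E} (he : e ∈ IsManifold.maximalAtlas I ∞ N) {y : E}
    (hy : y ∈ (e.extend I).target) {τ : ι → Bool} {s : Bool} {t : ℝ}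
    {B : TangentSpace I ((e.extend I).symm y) →L[ℝ] TangentSpace I ((e.extend I).symm y) →L[ℝ] ℝ}
    (hB : ∀ v, v ≠ 0 → 0 < B v v) {K : Submodule ℝ (TangentSpace I ((e.extend I).symm y))}
    {P : ℝ → (x : N) → TangentSpace I x →L[ℝ] TangentSpace I x}
    (hP : IsOrthProj B K (P t ((e.extend I).symm y)))
    (hmem : ∀ i, τ i = s → coordVec I e y (b i) ∈ K)
    (horth : ∀ i, τ i ≠ s → ∀ w ∈ K, B (coordVec I e y (b i)) w = 0) :
    endComp I b P e y t = factorProj τ s := by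
  ext k i
  rw [endComp, Matrix.of_apply, factorProj, Matrix.diagonal_apply]
  by_cases h : τ i = s
  · rw [hP.apply_of_mem hB (hmem i h), mfderiv_extend_coordVec he hy, Module.Basis.repr_self,
      Finsupp.single_apply]
    by_cases hki : k = i
    · subst hki; simp [h]
    · simp [hki, Ne.symm hki]
  · rw [hP.apply_of_orthogonal hB (horth i h)]
    have h0 : mfderiv I 𝓘(ℝ, E) (e.extend I) ((e.extend I).symm y) 0 = (0 : E) := map_zero _
    rw [h0, map_zero]
    by_cases hki : k = i
    · subst hki; simp [h]
    · simp [hki]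

end OrthogonalProjectionComponents

/-! ### Charts of the product manifold. -/

section ProductChart

set_option linter.unusedSectionVars false

variable {m n : ℕ}
  {Mh : Type*} [TopologicalSpace Mh] [ChartedSpace (EuclideanSpace ℝ (Fin m)) Mh]
  [IsManifold (𝓡 m) ∞ Mh]
  {Mc : Type*} [TopologicalSpace Mc] [ChartedSpace (EuclideanSpace ℝ (Fin n)) Mc]
  [IsManifold (𝓡 n) ∞ Mc]
  {e₁ : OpenPartialHomeomorph Mh (EuclideanSpace ℝ (Fin m))}
  {e₂ : OpenPartialHomeomorph Mc (EuclideanSpace ℝ (Fin n))}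

theorem stdBasis_inl (i : Fin m) :
    stdBasis m n (Sum.inl i) = (EuclideanSpace.basisFun (Fin m) ℝ i, 0) := by
  simp [stdBasis]

theorem stdBasis_inr (i : Fin n) :
    stdBasis m n (Sum.inr i) = (0, EuclideanSpace.basisFun (Fin n) ℝ i) := by
  simp [stdBasis]

theorem mem_target_fst {y : EuclideanSpace ℝ (Fin m) × EuclideanSpace ℝ (Fin n)}
    (hy : y ∈ ((e₁.prod e₂).extend ((𝓡 m).prod (𝓡 n))).target) :
    y.1 ∈ (e₁.extend (𝓡 m)).target := by
  rw [OpenPartialHomeomorph.extend_prod] at hy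
  exact hy.1

theorem mem_target_snd {y : EuclideanSpace ℝ (Fin m) × EuclideanSpace ℝ (Fin n)}
    (hy : y ∈ ((e₁.prod e₂).extend ((𝓡 m).prod (𝓡 n))).target) :
    y.2 ∈ (e₂.extend (𝓡 n)).target := by
  rw [OpenPartialHomeomorph.extend_prod] at hy
  exact hy.2

/-- Chain rule for the two sides of `Prod.fst ∘ (e₁ × e₂)⁻¹ = e₁⁻¹ ∘ Prod.fst`, which holds by
definition. -/
theorem mfderiv_fst_coordVec (he₁ : e₁ ∈ IsManifold.maximalAtlas (𝓡 m) ∞ Mh)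
    (he₂ : e₂ ∈ IsManifold.maximalAtlas (𝓡 n) ∞ Mc)
    {y : EuclideanSpace ℝ (Fin m) × EuclideanSpace ℝ (Fin n)}
    (hy : y ∈ ((e₁.prod e₂).extend ((𝓡 m).prod (𝓡 n))).target)
    (v : EuclideanSpace ℝ (Fin m) × EuclideanSpace ℝ (Fin n)) :
    mfderiv ((𝓡 m).prod (𝓡 n)) (𝓡 m) (Prod.fst : Mh × Mc → Mh)
      (((e₁.prod e₂).extend ((𝓡 m).prod (𝓡 n))).symm y)
      (coordVec ((𝓡 m).prod (𝓡 n)) (e₁.prod e₂) y v) = coordVec (𝓡 m) e₁ y.1 v.1 := by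
  have h1 := mfderiv_comp y (mdifferentiableAt_fst (I := 𝓡 m) (I' := 𝓡 n))
    (mdifferentiableAt_extend_symm (IsManifold.mem_maximalAtlas_prod he₁ he₂) hy)
  have h2 := mfderiv_comp (I := 𝓘(ℝ, EuclideanSpace ℝ (Fin m) × EuclideanSpace ℝ (Fin n)))
    (I' := 𝓘(ℝ, EuclideanSpace ℝ (Fin m))) (I'' := 𝓡 m) (g := (e₁.extend (𝓡 m)).symm)
    (f := Prod.fst) y (mdifferentiableAt_extend_symm he₁ (mem_target_fst hy))
    differentiableAt_fst.mdifferentiableAt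
  have h3 : (Prod.fst : Mh × Mc → Mh) ∘ ((e₁.prod e₂).extend ((𝓡 m).prod (𝓡 n))).symm =
      (e₁.extend (𝓡 m)).symm ∘ Prod.fst := rfl
  rw [h3, h2, mfderiv_eq_fderiv, fderiv_fst] at h1
  exact (DFunLike.congr_fun h1 v).symm

theorem mfderiv_snd_coordVec (he₁ : e₁ ∈ IsManifold.maximalAtlas (𝓡 m) ∞ Mh)
    (he₂ : e₂ ∈ IsManifold.maximalAtlas (𝓡 n) ∞ Mc)
    {y : EuclideanSpace ℝ (Fin m) × EuclideanSpace ℝ (Fin n)}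
    (hy : y ∈ ((e₁.prod e₂).extend ((𝓡 m).prod (𝓡 n))).target)
    (v : EuclideanSpace ℝ (Fin m) × EuclideanSpace ℝ (Fin n)) :
    mfderiv ((𝓡 m).prod (𝓡 n)) (𝓡 n) (Prod.snd : Mh × Mc → Mc)
      (((e₁.prod e₂).extend ((𝓡 m).prod (𝓡 n))).symm y)
      (coordVec ((𝓡 m).prod (𝓡 n)) (e₁.prod e₂) y v) = coordVec (𝓡 n) e₂ y.2 v.2 := by
  have h1 := mfderiv_comp y (mdifferentiableAt_snd (I := 𝓡 m) (I' := 𝓡 n))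
    (mdifferentiableAt_extend_symm (IsManifold.mem_maximalAtlas_prod he₁ he₂) hy)
  have h2 := mfderiv_comp (I := 𝓘(ℝ, EuclideanSpace ℝ (Fin m) × EuclideanSpace ℝ (Fin n)))
    (I' := 𝓘(ℝ, EuclideanSpace ℝ (Fin n))) (I'' := 𝓡 n) (g := (e₂.extend (𝓡 n)).symm)
    (f := Prod.snd) y (mdifferentiableAt_extend_symm he₂ (mem_target_snd hy))
    differentiableAt_snd.mdifferentiableAt
  have h3 : (Prod.snd : Mh × Mc → Mc) ∘ ((e₁.prod e₂).extend ((𝓡 m).prod (𝓡 n))).symm =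
      (e₂.extend (𝓡 n)).symm ∘ Prod.snd := rfl
  rw [h3, h2, mfderiv_eq_fderiv, fderiv_snd] at h1
  exact (DFunLike.congr_fun h1 v).symm

theorem isOpen_prod_extend_target :
    IsOpen ((e₁.prod e₂).extend ((𝓡 m).prod (𝓡 n))).target := by
  rw [OpenPartialHomeomorph.extend_prod]
  exact e₁.isOpen_extend_target.prod e₂.isOpen_extend_target

end ProductChart

end RicciProduct

/-! ### The theorem on the product manifold. -/

open RicciProduct
theorem mainTheorem4 {m n : ℕ}
    {Mh : Type*} [TopologicalSpace Mh] [ChartedSpace (EuclideanSpace ℝ (Fin m)) Mh]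
    [IsManifold (𝓡 m) ∞ Mh]
    {Mc : Type*} [TopologicalSpace Mc] [ChartedSpace (EuclideanSpace ℝ (Fin n)) Mc]
    [IsManifold (𝓡 n) ∞ Mc]
    -- the initial metrics on the two factors
    (gh : ContMDiffRiemannianMetric (𝓡 m) ∞ (EuclideanSpace ℝ (Fin m))
      (fun x : Mh => TangentSpace (𝓡 m) x))
    (gc : ContMDiffRiemannianMetric (𝓡 n) ∞ (EuclideanSpace ℝ (Fin n))
      (fun x : Mc => TangentSpace (𝓡 n) x))
    -- a smooth Ricci flow on the product that starts at the product metric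
    (T : ℝ) (hT : 0 < T)
    (g : ℝ → ContMDiffRiemannianMetric ((𝓡 m).prod (𝓡 n)) ∞
      (EuclideanSpace ℝ (Fin m) × EuclideanSpace ℝ (Fin n))
      (fun x : Mh × Mc => TangentSpace ((𝓡 m).prod (𝓡 n)) x))
    (hflow : IsSmoothRicciFlow ((𝓡 m).prod (𝓡 n)) (stdBasis m n) T g)
    (hprod : ∀ (x : Mh × Mc) (u v : TangentSpace ((𝓡 m).prod (𝓡 n)) x),
      (g 0).inner x u v =
        gh.inner x.1 (mfderiv ((𝓡 m).prod (𝓡 n)) (𝓡 m) Prod.fst x u)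
          (mfderiv ((𝓡 m).prod (𝓡 n)) (𝓡 m) Prod.fst x v)
        + gc.inner x.2 (mfderiv ((𝓡 m).prod (𝓡 n)) (𝓡 n) Prod.snd x u)
          (mfderiv ((𝓡 m).prod (𝓡 n)) (𝓡 n) Prod.snd x v))
    -- the projections, extended from time zero by the fibrewise ODE
    (Ph Pc : ℝ → (x : Mh × Mc) →
      TangentSpace ((𝓡 m).prod (𝓡 n)) x →L[ℝ] TangentSpace ((𝓡 m).prod (𝓡 n)) x)
    (hPh0 : ∀ x : Mh × Mc, IsOrthProj ((g 0).inner x)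
      (mfderiv ((𝓡 m).prod (𝓡 n)) (𝓡 n) (Prod.snd : Mh × Mc → Mc) x).ker (Ph 0 x))
    (hPc0 : ∀ x : Mh × Mc, IsOrthProj ((g 0).inner x)
      (mfderiv ((𝓡 m).prod (𝓡 n)) (𝓡 m) (Prod.fst : Mh × Mc → Mh) x).ker (Pc 0 x))
    (hPh : SolvesProjectionODE ((𝓡 m).prod (𝓡 n)) (stdBasis m n) T g Ph)
    (hPc : SolvesProjectionODE ((𝓡 m).prod (𝓡 n)) (stdBasis m n) T g Pc) :
    -- all components of the two tensors vanish at time zero, in every product chart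
    ∀ e₁ ∈ IsManifold.maximalAtlas (𝓡 m) ∞ Mh, ∀ e₂ ∈ IsManifold.maximalAtlas (𝓡 n) ∞ Mc,
    ∀ y ∈ ((e₁.prod e₂).extend ((𝓡 m).prod (𝓡 n))).target,
    ∀ k l : ℕ,
      ((Dt (stdBasis m n) (metricComp ((𝓡 m).prod (𝓡 n)) (stdBasis m n) g (e₁.prod e₂)) T)^[k]
        (nablaIter (stdBasis m n)
          (metricComp ((𝓡 m).prod (𝓡 n)) (stdBasis m n) g (e₁.prod e₂))
          (calR (stdBasis m n)
            (metricComp ((𝓡 m).prod (𝓡 n)) (stdBasis m n) g (e₁.prod e₂))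
            (endComp ((𝓡 m).prod (𝓡 n)) (stdBasis m n) Ph (e₁.prod e₂))
            (endComp ((𝓡 m).prod (𝓡 n)) (stdBasis m n) Pc (e₁.prod e₂))) l)) y 0 = 0 ∧
      ((Dt (stdBasis m n) (metricComp ((𝓡 m).prod (𝓡 n)) (stdBasis m n) g (e₁.prod e₂)) T)^[k]
        (nablaIter (stdBasis m n)
          (metricComp ((𝓡 m).prod (𝓡 n)) (stdBasis m n) g (e₁.prod e₂))
          (calP
            (endComp ((𝓡 m).prod (𝓡 n)) (stdBasis m n) Ph (e₁.prod e₂))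
            (endComp ((𝓡 m).prod (𝓡 n)) (stdBasis m n) Pc (e₁.prod e₂))) (l + 1))) y 0 = 0 := by
  intro e₁ he₁ e₂ he₂ y hy k l
  have he := IsManifold.mem_maximalAtlas_prod he₁ he₂
  have hU := isOpen_prod_extend_target (e₁ := e₁) (e₂ := e₂)
  have hfst := fun y hy => mfderiv_fst_coordVec he₁ he₂ (y := y) hy
  have hsnd := fun y hy => mfderiv_snd_coordVec he₁ he₂ (y := y) hy
  have hg0 : ∀ y ∈ ((e₁.prod e₂).extend ((𝓡 m).prod (𝓡 n))).target, ∀ i j,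
      metricComp ((𝓡 m).prod (𝓡 n)) (stdBasis m n) g (e₁.prod e₂) y 0 i j =
      gh.inner ((e₁.extend (𝓡 m)).symm y.1) (coordVec (𝓡 m) e₁ y.1 (stdBasis m n i).1)
        (coordVec (𝓡 m) e₁ y.1 (stdBasis m n j).1) +
      gc.inner ((e₂.extend (𝓡 n)).symm y.2) (coordVec (𝓡 n) e₂ y.2 (stdBasis m n i).2)
        (coordVec (𝓡 n) e₂ y.2 (stdBasis m n j).2) := by
    intro y hy i j
    rw [metricComp, Matrix.of_apply, hprod, hfst y hy, hfst y hy, hsnd y hy, hsnd y hy]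
    rfl
  have hgl : ∀ y ∈ ((e₁.prod e₂).extend ((𝓡 m).prod (𝓡 n))).target, ∀ i j : Fin m,
      metricComp ((𝓡 m).prod (𝓡 n)) (stdBasis m n) g (e₁.prod e₂) y 0 (Sum.inl i) (Sum.inl j) =
      gh.inner ((e₁.extend (𝓡 m)).symm y.1)
        (coordVec (𝓡 m) e₁ y.1 (EuclideanSpace.basisFun (Fin m) ℝ i))
        (coordVec (𝓡 m) e₁ y.1 (EuclideanSpace.basisFun (Fin m) ℝ j)) := by
    intro y hy i j
    rw [hg0 y hy, stdBasis_inl, stdBasis_inl, coordVec_zero, map_zero, add_zero]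
  have hgr : ∀ y ∈ ((e₁.prod e₂).extend ((𝓡 m).prod (𝓡 n))).target, ∀ i j : Fin n,
      metricComp ((𝓡 m).prod (𝓡 n)) (stdBasis m n) g (e₁.prod e₂) y 0 (Sum.inr i) (Sum.inr j) =
      gc.inner ((e₂.extend (𝓡 n)).symm y.2)
        (coordVec (𝓡 n) e₂ y.2 (EuclideanSpace.basisFun (Fin n) ℝ i))
        (coordVec (𝓡 n) e₂ y.2 (EuclideanSpace.basisFun (Fin n) ℝ j)) := by
    intro y hy i j
    rw [hg0 y hy, stdBasis_inr, stdBasis_inr, coordVec_zero, map_zero, zero_add]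
  have hline : ∀ y ∈ ((e₁.prod e₂).extend ((𝓡 m).prod (𝓡 n))).target, ∀ v,
      ∀ᶠ s : ℝ in nhds 0, y + s • v ∈ ((e₁.prod e₂).extend ((𝓡 m).prod (𝓡 n))).target := by
    intro y hy v
    have hc : ContinuousAt (fun s : ℝ => y + s • v) 0 := by fun_prop
    exact hc.eventually_mem (by simpa using hU.mem_nhds hy)
  have hpos : ∀ y, ∀ v, v ≠ 0 →
      0 < (g 0).inner (((e₁.prod e₂).extend ((𝓡 m).prod (𝓡 n))).symm y) v v := fun y v hv =>
    (g 0).pos _ v hv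
  have hsm := smoothOn_metricComp (b := stdBasis m n) he hflow.smooth
  have hdet := fun y hy t => det_metricComp_ne_zero (b := stdBasis m n) (g := g) he (y := y) hy t
  have hl : ∀ y ∈ ((e₁.prod e₂).extend ((𝓡 m).prod (𝓡 n))).target, ∀ i : Fin m,
      mfderiv ((𝓡 m).prod (𝓡 n)) (𝓡 n) (Prod.snd : Mh × Mc → Mc)
      (((e₁.prod e₂).extend ((𝓡 m).prod (𝓡 n))).symm y)
      (coordVec ((𝓡 m).prod (𝓡 n)) (e₁.prod e₂) y (stdBasis m n (Sum.inl i))) = 0 := by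
    intro y hy i
    refine (hsnd y hy _).trans ?_
    rw [stdBasis_inl]
    exact coordVec_zero e₂ y.2
  have hr : ∀ y ∈ ((e₁.prod e₂).extend ((𝓡 m).prod (𝓡 n))).target, ∀ i : Fin n,
      mfderiv ((𝓡 m).prod (𝓡 n)) (𝓡 m) (Prod.fst : Mh × Mc → Mh)
      (((e₁.prod e₂).extend ((𝓡 m).prod (𝓡 n))).symm y)
      (coordVec ((𝓡 m).prod (𝓡 n)) (e₁.prod e₂) y (stdBasis m n (Sum.inr i))) = 0 := by
    intro y hy i
    refine (hfst y hy _).trans ?_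
    rw [stdBasis_inr]
    exact coordVec_zero e₁ y.1
  have hPh' : ∀ y ∈ ((e₁.prod e₂).extend ((𝓡 m).prod (𝓡 n))).target,
      endComp ((𝓡 m).prod (𝓡 n)) (stdBasis m n) Ph (e₁.prod e₂) y 0 =
        factorProj Sum.isLeft true := by
    intro y hy
    refine endComp_eq_factorProj he hy (hpos y) (hPh0 _) ?_ ?_
    · rintro (i | i) hi
      · exact hl y hy i
      · simp at hi
    -- The differential of the first projection kills the coordinate vectors of the second factor,
    -- and that of the second projection kills `w`; so both terms of the product metric vanish.
    · rintro (i | i) hi w hw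
      · simp at hi
      · rw [hprod, hr y hy, show mfderiv ((𝓡 m).prod (𝓡 n)) (𝓡 n) (Prod.snd : Mh × Mc → Mc)
          (((e₁.prod e₂).extend ((𝓡 m).prod (𝓡 n))).symm y) w = 0 from hw, map_zero, map_zero,
          zero_apply, add_zero]
  have hPc' : ∀ y ∈ ((e₁.prod e₂).extend ((𝓡 m).prod (𝓡 n))).target,
      endComp ((𝓡 m).prod (𝓡 n)) (stdBasis m n) Pc (e₁.prod e₂) y 0 =
        factorProj Sum.isLeft false := by
    intro y hy
    refine endComp_eq_factorProj he hy (hpos y) (hPc0 _) ?_ ?_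
    · rintro (i | i) hi
      · simp at hi
      · exact hr y hy i
    · rintro (i | i) hi w hw
      · rw [hprod, hl y hy, show mfderiv ((𝓡 m).prod (𝓡 n)) (𝓡 m) (Prod.fst : Mh × Mc → Mh)
          (((e₁.prod e₂).extend ((𝓡 m).prod (𝓡 n))).symm y) w = 0 from hw, map_zero, map_zero,
          zero_apply, add_zero]
      · simp at hi
  refine Dt_iterate_nablaIter_eq_zero (τ := Sum.isLeft) hU hT hsm (fun y hy t _ => hdet y hy t)
    (hflow.flow _ he) ?_ ?_ hPh' hPc' (hPh _ he) (hPc _ he) hy k l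
  · rintro (i | i) (j | j) hij y hy
    · simp at hij
    · rw [hg0 y hy, stdBasis_inl, stdBasis_inr, coordVec_zero, coordVec_zero, map_zero, map_zero,
        zero_apply, add_zero]
    · rw [hg0 y hy, stdBasis_inl, stdBasis_inr, coordVec_zero, coordVec_zero, map_zero, map_zero,
        zero_apply, add_zero]
    · simp at hij
  · rintro (a | a) (i | i) (j | j) hij hai y hy
    · simp at hai
    · simp at hij
    · simp at hij
    -- Moving along a coordinate of the first factor leaves `y.2` unchanged, and the initial metric
    -- of the second factor depends on `y.2` only.
    · refine fderiv_eq_zero_of_eventually_const ?_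
      filter_upwards [hline y hy (stdBasis m n (Sum.inl a))] with s hs
      have h0 : (y + s • stdBasis m n (Sum.inl a)).2 = y.2 := by
        rw [stdBasis_inl, Prod.snd_add, Prod.smul_snd, smul_zero, add_zero]
      rw [hgr _ hs, hgr y hy, h0]
    · refine fderiv_eq_zero_of_eventually_const ?_
      filter_upwards [hline y hy (stdBasis m n (Sum.inr a))] with s hs
      have h0 : (y + s • stdBasis m n (Sum.inr a)).1 = y.1 := by
        rw [stdBasis_inr, Prod.fst_add, Prod.smul_fst, smul_zero, add_zero]
      rw [hgl _ hs, hgl y hy, h0]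
    · simp at hij
    · simp at hij
    · simp at hai
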